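/- Let $K$ be a commutative ring. A Lie superalgebra over $K$ is a $K$-module $L=L_{\bar 0}\oplus L_{\bar 1}$ with an even bilinear bracket such that, for homogeneous elements, $[x,y]=-(-1)^{|x||y|}[y,x]$ and $[x,[y,z]]=[[x,y],z]+(-1)^{|x||y|}[y,[x,z]]$, and such that $[x,x]=0$ for even $x$ and $[x,[x,x]]=0$ for odd $x$ (the last two conditions are automatic if $2$ and $3$ are invertible in $K$). Homomorphisms are even linear maps preserving the bracket. For a graded ideal $I$ of $L$ put $\gamma_1(I,L)=I$, $\gamma_{k+1}(I,L)=[\gamma_k(I,L),L]$ and $\gamma_k(L)=\gamma_k(L,L)$; put $Z_0(L)=0$ and $Z_{n+1}(L)=\{x\in L\mid [x,y]\in Z_n(L)\ \forall y\in L\}$. The graded ideal $I$ is called $n$-central if $I\subseteq Z_n(L)$. If $0\to R\to F\xrightarrow{\pi} L\to 0$ is a free presentation of $L$, where $F$ is the free Lie superalgebra on a $\mathbb Z_2$-graded set, the $c$-nilpotent multiplier of $L$ (computed from this presentation) is $\mathcal M^{(c)}(L)=(R\cap\gamma_{c+1}(F))/\gamma_{c+1}(R,F)$. For a crossed module $\partial:C\to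 P$ of Lie superalgebras, $C\wedge P$ denotes the non-abelian exterior product of the crossed $P$-modules $C$ and $P$, that is, the Lie superalgebra which carries the universal Lie super exterior pairing $C\times P\to C\wedge P$, $(m,n)\mapsto m\wedge n$. Here an even bilinear map $\rho:C\times P\to Q$ to a Lie superalgebra $Q$ is a Lie super exterior pairing if, for homogeneous elements, $\rho([m,m'],n)=\rho(m,[\partial m',n])-(-1)^{|m||m'|}\rho(m',[\partial m,n])$, $\rho(m,[n,n'])=(-1)^{|n'|(|m|+|n|)}\rho({}^{n'}m,n)-(-1)^{|m||n|}\rho({}^nm,n')$, $[\rho(m,n),\rho(m',n')]=-(-1)^{|m||n|}\rho({}^nm,[\partial m',n'])$, $\rho(m,\partial m')+(-1)^{|m||m'|}\rho(m',\partial m)=0$, and $\rho(m,\partial m)=0$ for even $m$. The Lie superalgebra $C\wedge P$ is again a crossed $P$-module, by $m\wedge n\mapsto[\partial m,n]$ and ${}^p(m\wedge n)={}^pm\wedge n+(-1)^{|p||m|}m\wedge[p,n]$. Put $C\wedge^0P=C$ and $C\wedge^{j+1}P=(C\wedge^jP)\wedge P$. For a graded ideal $M$ of $L$ the inclusion $M\to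 L$ is a crossed module. This defines $M\wedge^cL$ and the homomorphism $\theta_c:M\wedge^cL\to L$, $m\wedge l_1\wedge\cdots\wedge l_c\mapsto[\ldots[[m,l_1],l_2],\ldots,l_c]$. If $M$ is $n$-central, then $[\gamma_{n+1}(L),M]=0$, so that $M\to L/\gamma_{n+1}(L)$ is a crossed module as well, and this defines $M\wedge^c\bigl(L/\gamma_{n+1}(L)\bigr)$. **Proposition.** Let $M$ be a graded ideal of a Lie superalgebra $L$ over $K$, let $c\ge 1$, and let $0\to R\to F\xrightarrow{\pi}L\to0$ and $0\to S\to F'\xrightarrow{\rho}L/M\to0$ be free presentations, from which $\mathcal M^{(c)}(L)$ and $\mathcal M^{(c)}(L/M)$ are computed. Then there is a homomorphism $\varphi:\mathcal M^{(c)}(L)\to\mathcal M^{(c)}(L/M)$, induced by every homomorphism $F\to F'$ which lifts the projection $L\to L/M$, such that the following holds. 1. There is an exact sequence of Lie superalgebras $$\ker(\theta_c)\xrightarrow{\alpha}\mathcal M^{(c)}(L)\xrightarrow{\varphi}\mathcal M^{(c)}(L/M)\xrightarrow{\delta}\frac{M\cap\gamma_{c+1}(L)}{\gamma_{c+1}(M,L)}\to0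 .$$ 2. If $M$ is $n$-central for some $n\le c$, there is an exact sequence of Lie superalgebras $$M\wedge^c\frac{L}{\gamma_{n+1}(L)}\xrightarrow{\beta}\mathcal M^{(c)}(L)\xrightarrow{\varphi}\mathcal M^{(c)}(L/M)\xrightarrow{\varepsilon}M\cap\gamma_{c+1}(L)\to0 .$$ Here $\alpha$ is the restriction to $\ker(\theta_c)$ of a homomorphism $M\wedge^cL\to F/\gamma_{c+1}(R,F)$ which sends $\pi(x)\wedge\pi(y_1)\wedge\cdots\wedge\pi(y_c)$ to the class of $[\ldots[[x,y_1],y_2],\ldots,y_c]$ for all $x\in\pi^{-1}(M)$ and $y_1,\ldots,y_c\in F$. The map $\beta$ sends the element $\pi(x)\wedge\overline{\pi(y_1)}\wedge\cdots\wedge\overline{\pi(y_c)}$ to the same class. The maps $\delta$ and $\varepsilon$ are induced by every homomorphism $g:F'\to L$ which lifts $\rho$, i.e. they send the class of $y$ to the class of $g(y)$, respectively to $g(y)$. -/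

import Mathlib

universe u v w w₁ w₂

open scoped TensorProduct

noncomputable section

/-- The Koszul sign `(-1)^{ij}`. -/
def ksign (i j : ZMod 2) : ℤ := if i = 1 ∧ j = 1 then -1 else 1

@[simp] theorem ksign_zero_left (j : ZMod 2) : ksign 0 j = 1 := by simp [ksign]
@[simp] theorem ksign_zero_right (j : ZMod 2) : ksign j 0 = 1 := by simp [ksign]
@[simp] theorem ksign_one_one : ksign 1 1 = -1 := by simp [ksign]

theorem zmod_two_cases (i : ZMod 2) : i = 0 ∨ i = 1 := by revert i; decide

@[simp] theorem zmod_two_one_add_one : (1 : ZMod 2) + 1 = 0 := by decide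

/-- A (not necessarily associative) superalgebra over `K`: a module `A = A₀ ⊕ A₁` with an even
bilinear product `br`. -/
class SuperAlgebra (K : Type u) (A : Type v) [CommRing K] [AddCommGroup A] [Module K A] where
  grade : ZMod 2 → Submodule K A
  isCompl : IsCompl (grade 0) (grade 1)
  br : A →ₗ[K] A →ₗ[K] A
  br_mem : ∀ {i j : ZMod 2} {a b : A}, a ∈ grade i → b ∈ grade j → br a b ∈ grade (i + j)

/-- A Lie superalgebra over `K`.  The last two identities are consequences of the first two when
`2` and `3` are invertible in `K`. -/
class LieSuperalgebra (K : Type u) (A : Type v) [CommRing K] [AddCommGroup A] [Module K A]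
    extends SuperAlgebra K A where
  skew : ∀ {i j : ZMod 2} {a b : A}, a ∈ grade i → b ∈ grade j →
    br a b = -(ksign i j • br b a)
  jacobi : ∀ {i j k : ZMod 2} {a b c : A}, a ∈ grade i → b ∈ grade j → c ∈ grade k →
    br a (br b c) = br (br a b) c + ksign i j • br b (br a c)
  br_self_even : ∀ {a : A}, a ∈ grade 0 → br a a = 0
  br_br_self_odd : ∀ {a : A}, a ∈ grade 1 → br a (br a a) = 0

namespace SuperAlgebra

section Modules

variable {K : Type u} [CommRing K] {V : Type v} [AddCommGroup V] [Module K V]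

theorem disjoint_of_projection {G H : Submodule K V} (q : V →ₗ[K] V)
    (h0 : ∀ x ∈ G, q x = x) (h1 : ∀ x ∈ H, q x = 0) : Disjoint G H := by
  rw [Submodule.disjoint_def]
  intro x hx hy
  rw [← h0 x hx, h1 x hy]

theorem isCompl_map_mkQ {G H D : Submodule K V} (h : IsCompl G H)
    (hD : D ≤ (D ⊓ G) ⊔ (D ⊓ H)) : IsCompl (G.map D.mkQ) (H.map D.mkQ) := by
  constructor
  · rw [Submodule.disjoint_def]
    rintro _ ⟨x, hx, rfl⟩ ⟨y, hy, hxy⟩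
    have hd : y - x ∈ D := by
      rw [← Submodule.Quotient.eq]; exact hxy
    obtain ⟨a, ha, b, hb, hab⟩ := Submodule.mem_sup.1 (hD hd)
    have e : b - y = -(x + a) := by
      have : b = y - x - a := by rw [← hab]; abel
      rw [this]; abel
    have h1 : x + a ∈ G ⊓ H :=
      ⟨G.add_mem hx ha.2, by
        exact neg_mem_iff.1 (e ▸ H.sub_mem hb.2 hy)⟩
    rw [h.inf_eq_bot, Submodule.mem_bot] at h1
    have : x = -a := eq_neg_of_add_eq_zero_left h1
    rw [this]
    simpa using ha.1
  · rw [codisjoint_iff, ← Submodule.map_sup, h.sup_eq_top, Submodule.map_top,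
      Submodule.range_mkQ]

theorem isCompl_comap_subtype {G H D : Submodule K V} (h : IsCompl G H)
    (hD : D ≤ (D ⊓ G) ⊔ (D ⊓ H)) : IsCompl (G.comap D.subtype) (H.comap D.subtype) := by
  constructor
  · rw [Submodule.disjoint_def]
    rintro ⟨x, hx⟩ h0 h1
    have := (Submodule.disjoint_def.1 h.disjoint) x h0 h1
    simpa using this
  · rw [codisjoint_iff, eq_top_iff]
    rintro ⟨x, hx⟩ -
    obtain ⟨a, ha, b, hb, hab⟩ := Submodule.mem_sup.1 (hD hx)
    refine Submodule.mem_sup.2 ⟨⟨a, ha.1⟩, ha.2, ⟨b, hb.1⟩, hb.2, ?_⟩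
    exact Subtype.ext hab

theorem homog_span {G H : Submodule K V} {S : Set V} (hS : ∀ s ∈ S, s ∈ G ∨ s ∈ H) :
    Submodule.span K S ≤ (Submodule.span K S ⊓ G) ⊔ (Submodule.span K S ⊓ H) := by
  rw [Submodule.span_le]
  intro s hs
  rcases hS s hs with h | h
  · exact Submodule.mem_sup_left ⟨Submodule.subset_span hs, h⟩
  · exact Submodule.mem_sup_right ⟨Submodule.subset_span hs, h⟩

end Modules

variable {K : Type u} [CommRing K] {A : Type v} [AddCommGroup A] [Module K A] [SuperAlgebra K A]

theorem exists_decomp (K : Type u) [CommRing K] {A : Type v} [AddCommGroup A] [Module K A]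
    [SuperAlgebra K A] (x : A) :
    ∃ a ∈ grade (K := K) (A := A) 0, ∃ b ∈ grade (K := K) (A := A) 1, a + b = x :=
  Submodule.mem_sup.1 (by
    rw [(isCompl (K := K) (A := A)).sup_eq_top]; exact Submodule.mem_top)

/-- Every statement about elements that is additive holds once it holds for homogeneous ones. -/
theorem homog_induction (K : Type u) [CommRing K] {A : Type v} [AddCommGroup A] [Module K A]
    [SuperAlgebra K A] {p : A → Prop} (hadd : ∀ x y, p x → p y → p (x + y))
    (hom : ∀ i, ∀ x ∈ grade (K := K) (A := A) i, p x) (x : A) : p x := by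
  obtain ⟨a, ha, b, hb, rfl⟩ := exists_decomp K x
  exact hadd _ _ (hom _ a ha) (hom _ b hb)

/-- The projection of `A` onto its homogeneous component of degree `i`, as an endomorphism. -/
def proj (K : Type u) [CommRing K] (A : Type v) [AddCommGroup A] [Module K A]
    [SuperAlgebra K A] (i : ZMod 2) : A →ₗ[K] A :=
  if i = 0 then Submodule.projection _ _ (isCompl (K := K) (A := A))
  else Submodule.projection _ _ (isCompl (K := K) (A := A)).symm

theorem proj_same {i : ZMod 2} {x : A} (h : x ∈ grade (K := K) (A := A) i) :
    proj K A i x = x := by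
  rcases zmod_two_cases i with rfl | rfl
  · exact Submodule.projection_apply_left (isCompl (K := K) (A := A)) ⟨x, h⟩
  · simpa [proj] using
      Submodule.projection_apply_left (isCompl (K := K) (A := A)).symm ⟨x, h⟩

theorem proj_ne {i j : ZMod 2} (hij : i ≠ j) {x : A} (h : x ∈ grade (K := K) (A := A) j) :
    proj K A i x = 0 := by
  rcases zmod_two_cases i with rfl | rfl <;> rcases zmod_two_cases j with rfl | rfl
  · exact absurd rfl hij
  · simpa [proj] using h
  · simpa [proj] using h
  · exact absurd rfl hij

theorem sum_proj_single {M : Type w} [AddCommGroup M] (f : ZMod 2 → A →+ M) {i : ZMod 2} {x : A}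
    (h : x ∈ grade (K := K) (A := A) i) : ∑ j, f j (proj K A j x) = f i x := by
  rw [Finset.sum_eq_single i]
  · rw [proj_same h]
  · intro j _ hj
    rw [proj_ne hj h, map_zero]
  · simp

end SuperAlgebra

open SuperAlgebra

/-- Homomorphisms of superalgebras: even linear maps which preserve the product.  Between Lie
superalgebras these are the homomorphisms of Lie superalgebras. -/
structure SuperHom (K : Type u) (A : Type v) (B : Type w) [CommRing K] [AddCommGroup A]
    [Module K A] [SuperAlgebra K A] [AddCommGroup B] [Module K B] [SuperAlgebra K B] where
  toLinearMap : A →ₗ[K] B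
  map_grade : ∀ {i : ZMod 2} {a : A}, a ∈ grade (K := K) (A := A) i →
    toLinearMap a ∈ grade (K := K) (A := B) i
  map_br : ∀ a b : A, toLinearMap (br (K := K) a b) = br (K := K) (toLinearMap a) (toLinearMap b)

instance {K : Type u} {A : Type v} {B : Type w} [CommRing K] [AddCommGroup A]
    [Module K A] [SuperAlgebra K A] [AddCommGroup B] [Module K B] [SuperAlgebra K B] :
    CoeFun (SuperHom K A B) (fun _ => A → B) := ⟨fun f => f.toLinearMap⟩

/-- A graded two-sided ideal `I = (I ∩ A₀) ⊕ (I ∩ A₁)` of a superalgebra. -/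
structure GradedIdeal (K : Type u) (A : Type v) [CommRing K] [AddCommGroup A] [Module K A]
    [SuperAlgebra K A] where
  toSubmodule : Submodule K A
  homog : toSubmodule ≤ (toSubmodule ⊓ grade 0) ⊔ (toSubmodule ⊓ grade 1)
  br_left : ∀ (a : A) {x : A}, x ∈ toSubmodule → br (K := K) a x ∈ toSubmodule
  br_right : ∀ {x : A} (a : A), x ∈ toSubmodule → br (K := K) x a ∈ toSubmodule

namespace GradedIdeal

section Super

variable {K : Type u} [CommRing K] {A : Type v} [AddCommGroup A] [Module K A] [SuperAlgebra K A]
variable {B : Type w} [AddCommGroup B] [Module K B] [SuperAlgebra K B]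

theorem exists_decomp (I : GradedIdeal K A) {x : A} (hx : x ∈ I.toSubmodule) :
    ∃ a ∈ I.toSubmodule, a ∈ grade (K := K) (A := A) 0 ∧
      ∃ b ∈ I.toSubmodule, b ∈ grade (K := K) (A := A) 1 ∧ a + b = x := by
  obtain ⟨a, ha, b, hb, h⟩ := Submodule.mem_sup.1 (I.homog hx)
  exact ⟨a, ha.1, ha.2, b, hb.1, hb.2, h⟩

/-- The quotient of a superalgebra by a graded ideal. -/
instance instQuotient (I : GradedIdeal K A) : SuperAlgebra K (A ⧸ I.toSubmodule) where
  grade i := (grade (K := K) (A := A) i).map I.toSubmodule.mkQ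
  isCompl := isCompl_map_mkQ isCompl I.homog
  br := I.toSubmodule.liftQ
    (LinearMap.flip (I.toSubmodule.liftQ
      ((br (K := K) (A := A)).compr₂ I.toSubmodule.mkQ).flip
      (by
        intro x hx
        refine LinearMap.ext fun a => ?_
        exact (Submodule.Quotient.mk_eq_zero _).2 (I.br_left a hx))))
    (by
      intro x hx
      refine LinearMap.ext fun a => ?_
      obtain ⟨a, rfl⟩ := Submodule.mkQ_surjective _ a
      exact (Submodule.Quotient.mk_eq_zero _).2 (I.br_right a hx))
  br_mem := by
    rintro i j _ _ ⟨a, ha, rfl⟩ ⟨b, hb, rfl⟩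
    exact ⟨br (K := K) a b, br_mem ha hb, rfl⟩

@[simp] theorem mk_br (I : GradedIdeal K A) (a b : A) :
    br (K := K) (I.toSubmodule.mkQ a) (I.toSubmodule.mkQ b) = I.toSubmodule.mkQ (br (K := K) a b) :=
  rfl

/-- The projection `A → A / I`. -/
def toQuotient (I : GradedIdeal K A) : SuperHom K A (A ⧸ I.toSubmodule) where
  toLinearMap := I.toSubmodule.mkQ
  map_grade h := ⟨_, h, rfl⟩
  map_br _ _ := rfl

/-- A graded ideal, viewed as a superalgebra. -/
instance instSub (J : GradedIdeal K A) : SuperAlgebra K J.toSubmodule where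
  grade i := (grade (K := K) (A := A) i).comap J.toSubmodule.subtype
  isCompl := isCompl_comap_subtype isCompl J.homog
  br := LinearMap.mk₂ K (fun a b => ⟨br (K := K) (a : A) b, J.br_left _ b.2⟩)
    (by intros; ext; simp) (by intros; ext; simp) (by intros; ext; simp) (by intros; ext; simp)
  br_mem ha hb := br_mem (K := K) (A := A) ha hb

@[simp] theorem coe_br (J : GradedIdeal K A) (a b : J.toSubmodule) :
    ((br (K := K) a b : J.toSubmodule) : A) = br (K := K) (a : A) (b : A) := rfl

/-- The inclusion `J → A`. -/
def incl (J : GradedIdeal K A) : SuperHom K J.toSubmodule A where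
  toLinearMap := J.toSubmodule.subtype
  map_grade h := h
  map_br _ _ := rfl

/-- The preimage of a graded ideal under a homomorphism. -/
def comap (f : SuperHom K A B) (I : GradedIdeal K B) : GradedIdeal K A where
  toSubmodule := I.toSubmodule.comap f.toLinearMap
  homog := by
    intro x hx
    obtain ⟨a, ha, b, hb, rfl⟩ := SuperAlgebra.exists_decomp K x
    obtain ⟨a', ha', ha0, b', hb', hb1, h⟩ := I.exists_decomp hx
    have e : f a - a' = b' - f b := by
      have h2 : f (a + b) = f a + f b := map_add _ _ _
      have h3 : a' + b' = f a + f b := by rw [← h2]; exact h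
      rw [sub_eq_sub_iff_add_eq_add, ← h3]; abel
    have hz : f a - a' = 0 := by
      refine (Submodule.disjoint_def.1 (isCompl (K := K) (A := B)).disjoint) _
        (Submodule.sub_mem _ (f.map_grade ha) ha0) ?_
      rw [e]
      exact Submodule.sub_mem _ hb1 (f.map_grade hb)
    have hz' : b' - f b = 0 := by rw [← e]; exact hz
    refine Submodule.mem_sup.2 ⟨a, ⟨?_, ha⟩, b, ⟨?_, hb⟩, rfl⟩
    · change f a ∈ I.toSubmodule
      rw [sub_eq_zero.1 hz]; exact ha'
    · change f b ∈ I.toSubmodule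
      rw [← sub_eq_zero.1 hz']; exact hb'
  br_left a x hx := by
    change f.toLinearMap _ ∈ I.toSubmodule
    rw [f.map_br]; exact I.br_left _ hx
  br_right a hx := by
    change f.toLinearMap _ ∈ I.toSubmodule
    rw [f.map_br]; exact I.br_right _ hx

/-- The zero ideal. -/
instance instBot : Bot (GradedIdeal K A) := ⟨{
  toSubmodule := ⊥
  homog := bot_le
  br_left := by rintro a x hx; simp_all
  br_right := by rintro a x hx; simp_all }⟩

/-- The whole superalgebra as an ideal of itself. -/
instance instTop : Top (GradedIdeal K A) := ⟨{
  toSubmodule := ⊤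
  homog := by simp [(isCompl (K := K) (A := A)).sup_eq_top]
  br_left := by simp
  br_right := by simp }⟩

/-- The intersection of two graded ideals. -/
instance instMin : Min (GradedIdeal K A) := ⟨fun I J => {
  toSubmodule := I.toSubmodule ⊓ J.toSubmodule
  homog := by
    rintro x ⟨hI, hJ⟩
    obtain ⟨a, ha, ha0, b, hb, hb1, rfl⟩ := I.exists_decomp hI
    obtain ⟨a', ha', ha0', b', hb', hb1', h⟩ := J.exists_decomp hJ
    have e : a' - a = b - b' := by rw [sub_eq_sub_iff_add_eq_add, h]; abel
    have hz : a' - a = 0 := by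
      refine (Submodule.disjoint_def.1 (isCompl (K := K) (A := A)).disjoint) _
        (Submodule.sub_mem _ ha0' ha0) ?_
      rw [e]
      exact Submodule.sub_mem _ hb1 hb1'
    have hz' : b - b' = 0 := by rw [← e]; exact hz
    refine Submodule.mem_sup.2 ⟨a, ⟨⟨ha, ?_⟩, ha0⟩, b, ⟨⟨hb, ?_⟩, hb1⟩, rfl⟩
    · rw [← sub_eq_zero.1 hz]; exact ha'
    · rw [sub_eq_zero.1 hz']; exact hb'
  br_left := fun a x hx => ⟨I.br_left a hx.1, J.br_left a hx.2⟩
  br_right := fun a hx => ⟨I.br_right a hx.1, J.br_right a hx.2⟩ }⟩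

/-- The kernel of a homomorphism. -/
def ker (f : SuperHom K A B) : GradedIdeal K A := comap f ⊥

/-- `J ∩ I`, as a graded ideal of the superalgebra `J`. -/
def restrict (J I : GradedIdeal K A) : GradedIdeal K J.toSubmodule := comap J.incl I

/-- The subquotient `J / (J ∩ I)`, which is `J / I` when `I ⊆ J`. -/
abbrev Subquotient (J I : GradedIdeal K A) : Type v := J.toSubmodule ⧸ (J.restrict I).toSubmodule

/-- The injection `J / (J ∩ I) → A / I` induced by the inclusion of `J` in `A`. -/
def subquotientIncl (J I : GradedIdeal K A) :
    SuperHom K (Subquotient J I) (A ⧸ I.toSubmodule) where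
  toLinearMap := Submodule.mapQ _ _ J.toSubmodule.subtype le_rfl
  map_grade := by
    rintro i _ ⟨x, hx, rfl⟩
    exact ⟨(x : A), hx, rfl⟩
  map_br := by
    intro a b
    obtain ⟨a, rfl⟩ := Submodule.mkQ_surjective _ a
    obtain ⟨b, rfl⟩ := Submodule.mkQ_surjective _ b
    rfl

theorem subquotientIncl_injective (J I : GradedIdeal K A) :
    Function.Injective (subquotientIncl J I) := by
  refine (injective_iff_map_eq_zero (subquotientIncl J I).toLinearMap).2 fun x hx => ?_
  obtain ⟨x, rfl⟩ := Submodule.mkQ_surjective _ x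
  have h1 : I.toSubmodule.mkQ (x : A) = 0 := hx
  rw [Submodule.mkQ_apply, Submodule.Quotient.mk_eq_zero] at h1
  rw [Submodule.mkQ_apply, Submodule.Quotient.mk_eq_zero]
  exact h1

end Super

section Lie

variable {K : Type u} [CommRing K] {L : Type v} [AddCommGroup L] [Module K L] [LieSuperalgebra K L]

/-- The quotient of a Lie superalgebra by a graded ideal. -/
instance instQuotientLie (I : GradedIdeal K L) : LieSuperalgebra K (L ⧸ I.toSubmodule) where
  toSuperAlgebra := instQuotient I
  skew := by
    rintro i j _ _ ⟨a, ha, rfl⟩ ⟨b, hb, rfl⟩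
    rw [mk_br, mk_br, LieSuperalgebra.skew ha hb, map_neg, map_zsmul]
  jacobi := by
    rintro i j k _ _ _ ⟨a, ha, rfl⟩ ⟨b, hb, rfl⟩ ⟨c, hc, rfl⟩
    simp only [mk_br]
    rw [LieSuperalgebra.jacobi ha hb hc, map_add, map_zsmul]
  br_self_even := by
    rintro _ ⟨a, ha, rfl⟩
    rw [mk_br, LieSuperalgebra.br_self_even ha, map_zero]
  br_br_self_odd := by
    rintro _ ⟨a, ha, rfl⟩
    rw [mk_br, mk_br, LieSuperalgebra.br_br_self_odd ha, map_zero]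

/-- A graded ideal of a Lie superalgebra is a Lie superalgebra. -/
instance instSubLie (J : GradedIdeal K L) : LieSuperalgebra K J.toSubmodule where
  toSuperAlgebra := instSub J
  skew ha hb := Subtype.ext (LieSuperalgebra.skew (K := K) (A := L) ha hb)
  jacobi ha hb hc := Subtype.ext (LieSuperalgebra.jacobi (K := K) (A := L) ha hb hc)
  br_self_even ha := Subtype.ext (LieSuperalgebra.br_self_even (K := K) (A := L) ha)
  br_br_self_odd ha := Subtype.ext (LieSuperalgebra.br_br_self_odd (K := K) (A := L) ha)

/-- For a graded ideal `I` of `L`, the graded ideal `[I, L]` spanned by all brackets `[x, y]` with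
`x ∈ I` and `y ∈ L`. -/
def bracketTop (I : GradedIdeal K L) : GradedIdeal K L where
  toSubmodule := Submodule.span K {z | ∃ x ∈ I.toSubmodule, ∃ y : L, br (K := K) x y = z}
  homog := by
    rw [Submodule.span_le]
    rintro _ ⟨x, hx, y, rfl⟩
    obtain ⟨a, ha, ha0, b, hb, hb1, rfl⟩ := I.exists_decomp hx
    obtain ⟨c, hc, d, hd, rfl⟩ := SuperAlgebra.exists_decomp K y
    refine Submodule.mem_sup.2 ⟨br (K := K) a c + br (K := K) b d, ⟨?_, ?_⟩,
      br (K := K) a d + br (K := K) b c, ⟨?_, ?_⟩, ?_⟩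
    · exact Submodule.add_mem _ (Submodule.subset_span ⟨a, ha, c, rfl⟩)
        (Submodule.subset_span ⟨b, hb, d, rfl⟩)
    · exact Submodule.add_mem _ (by simpa using br_mem ha0 hc) (by simpa using br_mem hb1 hd)
    · exact Submodule.add_mem _ (Submodule.subset_span ⟨a, ha, d, rfl⟩)
        (Submodule.subset_span ⟨b, hb, c, rfl⟩)
    · exact Submodule.add_mem _ (by simpa using br_mem ha0 hd) (by simpa using br_mem hb1 hc)
    · simp only [map_add, LinearMap.add_apply]; abel
  br_left a x hx := by
    suffices h : Submodule.span K {z | ∃ x ∈ I.toSubmodule, ∃ y : L, br (K := K) x y = z} ≤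
        (Submodule.span K {z | ∃ x ∈ I.toSubmodule, ∃ y : L, br (K := K) x y = z}).comap
          (br (K := K) a) from h hx
    rw [Submodule.span_le]
    rintro _ ⟨x, hx, y, rfl⟩
    change br (K := K) a (br (K := K) x y) ∈ Submodule.span K _
    refine homog_induction K (p := fun a => br (K := K) a (br (K := K) x y) ∈
      Submodule.span K {z | ∃ x ∈ I.toSubmodule, ∃ y : L, br (K := K) x y = z}) ?_ ?_ a
    · intro a b ha hb
      rw [map_add, LinearMap.add_apply]; exact Submodule.add_mem _ ha hb
    intro i a ha
    refine homog_induction K (p := fun y => br (K := K) a (br (K := K) x y) ∈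
      Submodule.span K {z | ∃ x ∈ I.toSubmodule, ∃ y : L, br (K := K) x y = z}) ?_ ?_ y
    · intro y z hy hz
      rw [map_add, map_add]; exact Submodule.add_mem _ hy hz
    intro k y hy
    obtain ⟨x0, hx0, h0, x1, hx1, h1, rfl⟩ := I.exists_decomp hx
    rw [map_add, LinearMap.add_apply, map_add]
    have key : ∀ j, ∀ x ∈ I.toSubmodule, x ∈ grade (K := K) (A := L) j →
        br (K := K) a (br (K := K) x y) ∈
          Submodule.span K {z | ∃ x ∈ I.toSubmodule, ∃ y : L, br (K := K) x y = z} := by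
      intro j x hx hj
      rw [LieSuperalgebra.jacobi ha hj hy]
      refine Submodule.add_mem _ (Submodule.subset_span ⟨_, I.br_left a hx, y, rfl⟩) ?_
      have h2 : br (K := K) x (br (K := K) a y) ∈
          Submodule.span K {z | ∃ x ∈ I.toSubmodule, ∃ y : L, br (K := K) x y = z} :=
        Submodule.subset_span ⟨x, hx, _, rfl⟩
      exact zsmul_mem h2 _
    exact Submodule.add_mem _ (key 0 x0 hx0 h0) (key 1 x1 hx1 h1)
  br_right {x} a hx := by
    have hI : Submodule.span K {z | ∃ x ∈ I.toSubmodule, ∃ y : L, br (K := K) x y = z} ≤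
        I.toSubmodule := by
      rw [Submodule.span_le]
      rintro _ ⟨x, hx, y, rfl⟩
      exact I.br_right y hx
    exact Submodule.subset_span ⟨x, hI hx, a, rfl⟩

/-- The relative lower central series, indexed from `0`: `I.lcs k` is `γ_{k+1}(I, L)`, where
`γ₁(I, L) = I` and `γ_{k+1}(I, L) = [γ_k(I, L), L]`.  In particular
`(⊤ : GradedIdeal K L).lcs k` is the term `γ_{k+1}(L)` of the lower central series of `L`. -/
def lcs (I : GradedIdeal K L) : ℕ → GradedIdeal K L
  | 0 => I
  | k + 1 => (lcs I k).bracketTop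

theorem lcs_le (I : GradedIdeal K L) (k : ℕ) : (I.lcs k).toSubmodule ≤ I.toSubmodule := by
  induction k with
  | zero => exact le_rfl
  | succ k ih =>
    refine Submodule.span_le.2 ?_
    rintro _ ⟨x, hx, y, rfl⟩
    exact I.br_right y (ih hx)

theorem lcs_le_inf (I : GradedIdeal K L) (k : ℕ) :
    (I.lcs k).toSubmodule ≤ (I ⊓ (⊤ : GradedIdeal K L).lcs k).toSubmodule := by
  refine le_inf (I.lcs_le k) ?_
  induction k with
  | zero => exact le_top
  | succ k ih =>
    refine Submodule.span_mono ?_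
    rintro _ ⟨x, hx, y, rfl⟩
    exact ⟨x, ih hx, y, rfl⟩

end Lie

end GradedIdeal

/-- The terms `Z_n(L)` of the upper central series: `Z₀(L) = 0` and
`Z_{n+1}(L) = {x | [x, y] ∈ Z_n(L) for all y}`. -/
def upperCentral (K : Type u) (L : Type v) [CommRing K] [AddCommGroup L] [Module K L]
    [LieSuperalgebra K L] : ℕ → Submodule K L
  | 0 => ⊥
  | n + 1 => ⨅ y : L, (upperCentral K L n).comap ((br (K := K) (A := L)).flip y)

theorem mem_upperCentral_succ {K : Type u} {L : Type v} [CommRing K] [AddCommGroup L] [Module K L]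
    [LieSuperalgebra K L] {n : ℕ} {x : L} :
    x ∈ upperCentral K L (n + 1) ↔ ∀ y : L, br (K := K) x y ∈ upperCentral K L n := by
  simp [upperCentral]

/-- A graded ideal `M` of `L` is `n`-central if `M ⊆ Z_n(L)`. -/
def GradedIdeal.IsCentral {K : Type u} {L : Type v} [CommRing K] [AddCommGroup L] [Module K L]
    [LieSuperalgebra K L] (M : GradedIdeal K L) (n : ℕ) : Prop :=
  M.toSubmodule ≤ upperCentral K L n

theorem GradedIdeal.br_lcs_mem {K : Type u} {L : Type v} [CommRing K] [AddCommGroup L]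
    [Module K L] [LieSuperalgebra K L] (k : ℕ) : ∀ (n : ℕ) {i : ZMod 2} {x : L},
    x ∈ grade (K := K) (A := L) i → x ∈ upperCentral K L (n + k + 1) →
    ∀ g ∈ ((⊤ : GradedIdeal K L).lcs k).toSubmodule,
      br (K := K) x g ∈ upperCentral K L n ∧ br (K := K) g x ∈ upperCentral K L n := by
  have flip : ∀ (n : ℕ) {i : ZMod 2} {x : L}, x ∈ grade (K := K) (A := L) i → ∀ I : GradedIdeal K L,
      (∀ g ∈ I.toSubmodule, br (K := K) x g ∈ upperCentral K L n) →
      ∀ g ∈ I.toSubmodule, br (K := K) g x ∈ upperCentral K L n := by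
    intro n i x hx I h g hg
    obtain ⟨a, ha, ha0, b, hb, hb1, rfl⟩ := I.exists_decomp hg
    rw [map_add, LinearMap.add_apply, LieSuperalgebra.skew ha0 hx, LieSuperalgebra.skew hb1 hx]
    exact Submodule.add_mem _ (neg_mem (zsmul_mem (h a ha) _)) (neg_mem (zsmul_mem (h b hb) _))
  suffices H : ∀ (n : ℕ) {i : ZMod 2} {x : L},
      x ∈ grade (K := K) (A := L) i → x ∈ upperCentral K L (n + k + 1) →
      ∀ g ∈ ((⊤ : GradedIdeal K L).lcs k).toSubmodule, br (K := K) x g ∈ upperCentral K L n from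
    fun n i x hx hz g hg => ⟨H n hx hz g hg, flip n hx _ (H n hx hz) g hg⟩
  induction k with
  | zero =>
    intro n i x _ hz g _
    exact mem_upperCentral_succ.1 hz g
  | succ k ih =>
    intro n i x hx hz g hg
    suffices h : ((⊤ : GradedIdeal K L).lcs (k + 1)).toSubmodule ≤
        (upperCentral K L n).comap (br (K := K) x) from h hg
    refine Submodule.span_le.2 ?_
    rintro _ ⟨a, ha, y, rfl⟩
    change br (K := K) x (br (K := K) a y) ∈ upperCentral K L n
    refine homog_induction K (p := fun y => br (K := K) x (br (K := K) a y) ∈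
      upperCentral K L n) ?_ ?_ y
    · intro y z hy hz
      rw [map_add, map_add]; exact Submodule.add_mem _ hy hz
    intro j y hy
    have hxy : br (K := K) x y ∈ upperCentral K L (n + k + 1) := mem_upperCentral_succ.1 hz y
    have key : ∀ l, ∀ a ∈ ((⊤ : GradedIdeal K L).lcs k).toSubmodule,
        a ∈ grade (K := K) (A := L) l →
        br (K := K) x (br (K := K) a y) ∈ upperCentral K L n := by
      intro l a ha hl
      rw [LieSuperalgebra.jacobi hx hl hy]
      refine Submodule.add_mem _ ?_ (zsmul_mem ?_ _)
      · refine mem_upperCentral_succ.1 (ih (n + 1) hx ?_ a ha) y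
        rwa [show n + 1 + k + 1 = n + (k + 1) + 1 by ring]
      · exact flip n (br_mem hx hy) _ (ih n (br_mem hx hy) hxy) a ha
    obtain ⟨a0, h0, h0', a1, h1, h1', rfl⟩ := GradedIdeal.exists_decomp _ ha
    rw [map_add, LinearMap.add_apply, map_add]
    exact Submodule.add_mem _ (key 0 a0 h0 h0') (key 1 a1 h1 h1')

theorem upperCentral_le_succ (K : Type u) (L : Type v) [CommRing K] [AddCommGroup L] [Module K L]
    [LieSuperalgebra K L] (n : ℕ) : upperCentral K L n ≤ upperCentral K L (n + 1) := by
  induction n with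
  | zero => exact bot_le
  | succ n ih =>
    intro x hx
    exact mem_upperCentral_succ.2 fun y => ih (mem_upperCentral_succ.1 hx y)

/-- If `M` is `n`-central then `[γ_{n+1}(L), M] = 0`. -/
theorem GradedIdeal.IsCentral.br_lcs_eq_zero {K : Type u} {L : Type v} [CommRing K]
    [AddCommGroup L] [Module K L] [LieSuperalgebra K L] {M : GradedIdeal K L} {n : ℕ}
    (h : M.IsCentral n) : ∀ g ∈ ((⊤ : GradedIdeal K L).lcs n).toSubmodule,
    ∀ m ∈ M.toSubmodule, br (K := K) g m = 0 := by
  intro g hg m hm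
  have key : ∀ i, ∀ m ∈ M.toSubmodule, m ∈ grade (K := K) (A := L) i → br (K := K) g m = 0 := by
    intro i m hm hi
    have := (br_lcs_mem n 0 hi (by
      rw [Nat.zero_add]; exact upperCentral_le_succ K L n (h hm)) g hg).2
    simpa [upperCentral] using this
  obtain ⟨a, ha, ha0, b, hb, hb1, rfl⟩ := M.exists_decomp hm
  rw [map_add, key 0 a ha ha0, key 1 b hb hb1, add_zero]

/-! ### Free Lie superalgebras -/

section Free

/-- The degree of a non-associative monomial in letters of the given degrees. -/
def monomialDegree {X : Type w} (d : X → ZMod 2) : FreeMagma X → ZMod 2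
  | .of x => d x
  | .mul s t => monomialDegree d s + monomialDegree d t

/-- The free non-associative `K`-algebra on the `ℤ/2`-graded set `X` with degree function `d`. -/
def FreeSuper (K : Type u) [CommRing K] {X : Type w} (_d : X → ZMod 2) : Type (max u w) :=
  FreeNonUnitalNonAssocAlgebra K X

variable (K : Type u) [CommRing K] {X : Type w} (d : X → ZMod 2)

instance : AddCommGroup (FreeSuper K d) :=
  inferInstanceAs (AddCommGroup (FreeNonUnitalNonAssocAlgebra K X))

instance : Module K (FreeSuper K d) :=
  inferInstanceAs (Module K (FreeNonUnitalNonAssocAlgebra K X))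

theorem mul_mem_supported {i j : ZMod 2} {a b : FreeNonUnitalNonAssocAlgebra K X}
    (ha : a ∈ MonoidAlgebra.supported K K {s : FreeMagma X | monomialDegree d s = i})
    (hb : b ∈ MonoidAlgebra.supported K K {s : FreeMagma X | monomialDegree d s = j}) :
    a * b ∈ MonoidAlgebra.supported K K {s : FreeMagma X | monomialDegree d s = i + j} := by
  rw [MonoidAlgebra.supported_eq_span_single] at ha hb
  induction ha, hb using Submodule.span_induction₂ with
  | mem_mem a b ha hb =>
    obtain ⟨s, hs, rfl⟩ := ha
    obtain ⟨t, ht, rfl⟩ := hb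
    have hs' : monomialDegree d s = i := hs
    have ht' : monomialDegree d t = j := ht
    rw [MonoidAlgebra.single_mul_single, MonoidAlgebra.supported_eq_span_single]
    refine Submodule.subset_span ⟨s * t, ?_, by simp⟩
    change monomialDegree d s + monomialDegree d t = i + j
    rw [hs', ht']
  | zero_left => simp
  | zero_right => simp
  | add_left _ _ _ _ _ _ h h' => rw [add_mul]; exact add_mem h h'
  | add_right _ _ _ _ _ _ h h' => rw [mul_add]; exact add_mem h h'
  | smul_left r _ _ _ _ h => rw [smul_mul_assoc]; exact Submodule.smul_mem _ r h
  | smul_right r _ _ _ _ h => rw [mul_smul_comm]; exact Submodule.smul_mem _ r h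

/-- The grading by the degree of monomials. -/
instance : SuperAlgebra K (FreeSuper K d) where
  grade i := MonoidAlgebra.supported K K {s : FreeMagma X | monomialDegree d s = i}
  isCompl := by
    have hc : IsCompl {s : FreeMagma X | monomialDegree d s = 0}
        {s : FreeMagma X | monomialDegree d s = 1} := by
      constructor
      · rw [Set.disjoint_left]
        intro s h0 h1
        exact absurd (h0.symm.trans h1) (by decide)
      · rw [codisjoint_iff]
        exact Set.eq_univ_iff_forall.2 fun s => zmod_two_cases _
    have h : IsCompl (Finsupp.supported K K {s : FreeMagma X | monomialDegree d s = 0})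
        (Finsupp.supported K K {s : FreeMagma X | monomialDegree d s = 1}) :=
      ⟨Finsupp.disjoint_supported_supported (M := K) (R := K) hc.disjoint,
        Finsupp.codisjoint_supported_supported (M := K) (R := K) hc.codisjoint⟩
    exact (OrderIso.isCompl_iff
      (Submodule.orderIsoMapComap (MonoidAlgebra.coeffLinearEquiv (S := K) K)).symm).1 h
  br := LinearMap.mul K (FreeNonUnitalNonAssocAlgebra K X)
  br_mem ha hb := mul_mem_supported K d ha hb

/-- The elements expressing the identities of a Lie superalgebra, in homogeneous elements of the
free non-associative algebra, together with all their multiples by homogeneous elements. -/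
inductive LieRel : FreeSuper K d → Prop
  | skew {i j : ZMod 2} {a b : FreeSuper K d} (ha : a ∈ grade (K := K) i)
      (hb : b ∈ grade (K := K) j) : LieRel (br (K := K) a b + ksign i j • br (K := K) b a)
  | jacobi {i j k : ZMod 2} {a b c : FreeSuper K d} (ha : a ∈ grade (K := K) i)
      (hb : b ∈ grade (K := K) j) (hc : c ∈ grade (K := K) k) :
      LieRel (br (K := K) a (br (K := K) b c) - br (K := K) (br (K := K) a b) c
        - ksign i j • br (K := K) b (br (K := K) a c))
  | even {a : FreeSuper K d} (ha : a ∈ grade (K := K) 0) : LieRel (br (K := K) a a)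
  | odd {a : FreeSuper K d} (ha : a ∈ grade (K := K) 1) :
      LieRel (br (K := K) a (br (K := K) a a))
  | mul_left {i : ZMod 2} {a x : FreeSuper K d} (ha : a ∈ grade (K := K) i) (hx : LieRel x) :
      LieRel (br (K := K) a x)
  | mul_right {i : ZMod 2} {a x : FreeSuper K d} (ha : a ∈ grade (K := K) i) (hx : LieRel x) :
      LieRel (br (K := K) x a)

theorem LieRel.homogeneous {x : FreeSuper K d} (h : LieRel K d x) :
    ∃ i : ZMod 2, x ∈ grade (K := K) i := by
  induction h with
  | @skew i j a b ha hb =>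
    exact ⟨i + j, add_mem (br_mem ha hb) (zsmul_mem (by rw [add_comm]; exact br_mem hb ha) _)⟩
  | @jacobi i j k a b c ha hb hc =>
    refine ⟨i + (j + k), sub_mem (sub_mem (br_mem ha (br_mem hb hc)) ?_) (zsmul_mem ?_ _)⟩
    · rw [← add_assoc]; exact br_mem (br_mem ha hb) hc
    · rw [add_left_comm]; exact br_mem hb (br_mem ha hc)
  | even ha => exact ⟨_, br_mem ha ha⟩
  | odd ha => exact ⟨_, br_mem ha (br_mem ha ha)⟩
  | mul_left ha _ ih => obtain ⟨j, hj⟩ := ih; exact ⟨_, br_mem ha hj⟩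
  | mul_right ha _ ih => obtain ⟨j, hj⟩ := ih; exact ⟨_, br_mem hj ha⟩

/-- The two-sided graded ideal generated by the identities of a Lie superalgebra. -/
def lieIdeal : GradedIdeal K (FreeSuper K d) where
  toSubmodule := Submodule.span K {x | LieRel K d x}
  homog := homog_span (by
    intro s hs
    obtain ⟨i, hi⟩ := LieRel.homogeneous K d hs
    rcases zmod_two_cases i with rfl | rfl
    · exact Or.inl hi
    · exact Or.inr hi)
  br_left a x hx := by
    refine homog_induction K (p := fun a => br (K := K) a x ∈ Submodule.span K {x | LieRel K d x})
      ?_ ?_ a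
    · intro a b ha hb
      rw [map_add, LinearMap.add_apply]; exact Submodule.add_mem _ ha hb
    · intro i a ha
      have h : Submodule.span K {x | LieRel K d x} ≤
          (Submodule.span K {x | LieRel K d x}).comap (br (K := K) a) :=
        Submodule.span_le.2 fun y hy => Submodule.subset_span (LieRel.mul_left ha hy)
      exact h hx
  br_right {x} a hx := by
    refine homog_induction K (p := fun a => br (K := K) x a ∈ Submodule.span K {x | LieRel K d x})
      ?_ ?_ a
    · intro a b ha hb
      rw [map_add]; exact Submodule.add_mem _ ha hb
    · intro i a ha
      have h : Submodule.span K {x | LieRel K d x} ≤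
          (Submodule.span K {x | LieRel K d x}).comap ((br (K := K)).flip a) :=
        Submodule.span_le.2 fun y hy => Submodule.subset_span (LieRel.mul_right ha hy)
      exact h hx

/-- The free Lie superalgebra over `K` on the `ℤ/2`-graded set `X` with degree function `d`. -/
abbrev FreeLieSuper : Type (max u w) := FreeSuper K d ⧸ (lieIdeal K d).toSubmodule

instance : LieSuperalgebra K (FreeLieSuper K d) where
  toSuperAlgebra := GradedIdeal.instQuotient (lieIdeal K d)
  skew := by
    rintro i j _ _ ⟨a, ha, rfl⟩ ⟨b, hb, rfl⟩
    have h := (Submodule.Quotient.mk_eq_zero (lieIdeal K d).toSubmodule).2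
      (Submodule.subset_span (LieRel.skew ha hb))
    exact eq_neg_of_add_eq_zero_left h
  jacobi := by
    rintro i j k _ _ _ ⟨a, ha, rfl⟩ ⟨b, hb, rfl⟩ ⟨c, hc, rfl⟩
    have h := (Submodule.Quotient.mk_eq_zero (lieIdeal K d).toSubmodule).2
      (Submodule.subset_span (LieRel.jacobi ha hb hc))
    exact sub_eq_iff_eq_add'.1 (sub_eq_zero.1 h)
  br_self_even := by
    rintro _ ⟨a, ha, rfl⟩
    exact (Submodule.Quotient.mk_eq_zero (lieIdeal K d).toSubmodule).2
      (Submodule.subset_span (LieRel.even ha))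
  br_br_self_odd := by
    rintro _ ⟨a, ha, rfl⟩
    exact (Submodule.Quotient.mk_eq_zero (lieIdeal K d).toSubmodule).2
      (Submodule.subset_span (LieRel.odd ha))

/-- The free generators. -/
def FreeLieSuper.of (x : X) : FreeLieSuper K d :=
  (lieIdeal K d).toSubmodule.mkQ (FreeNonUnitalNonAssocAlgebra.of K x)

variable {Q : Type v} [AddCommGroup Q] [Module K Q] [LieSuperalgebra K Q]

/-- The value of a monomial under a substitution of the letters. -/
def evalMonomial (f : X → Q) : FreeMagma X → Q
  | .of x => f x
  | .mul s t => br (K := K) (evalMonomial f s) (evalMonomial f t)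

/-- The linear extension of `evalMonomial`. -/
def evalFree (f : X → Q) : FreeNonUnitalNonAssocAlgebra K X →ₗ[K] Q :=
  Finsupp.linearCombination K (evalMonomial K f) ∘ₗ
    (MonoidAlgebra.coeffLinearEquiv (S := K) (M := FreeMagma X) K).toLinearMap

theorem evalFree_single (f : X → Q) (s : FreeMagma X) (r : K) :
    evalFree K f (MonoidAlgebra.single s r) = r • evalMonomial K f s :=
  Finsupp.linearCombination_single K r s

theorem span_single : Submodule.span K (Set.range fun s : FreeMagma X =>
    (MonoidAlgebra.single s 1 : FreeNonUnitalNonAssocAlgebra K X)) = ⊤ := by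
  have h := MonoidAlgebra.supported_eq_span_single K (Set.univ : Set (FreeMagma X))
  rw [Set.image_univ] at h
  rw [← h, eq_top_iff]
  intro x _
  rw [MonoidAlgebra.mem_supported]
  exact Set.subset_univ _

theorem free_induction {p : FreeNonUnitalNonAssocAlgebra K X → Prop}
    (h0 : p 0) (hadd : ∀ x y, p x → p y → p (x + y)) (hsmul : ∀ (r : K) x, p x → p (r • x))
    (h : ∀ s : FreeMagma X, p (MonoidAlgebra.single s 1)) (x : FreeNonUnitalNonAssocAlgebra K X) :
    p x := by
  have hx : x ∈ Submodule.span K (Set.range fun s : FreeMagma X =>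
      (MonoidAlgebra.single s 1 : FreeNonUnitalNonAssocAlgebra K X)) := by
    rw [span_single]; trivial
  induction hx using Submodule.span_induction with
  | mem x hx => obtain ⟨s, rfl⟩ := hx; exact h s
  | zero => exact h0
  | add x y _ _ hx hy => exact hadd x y hx hy
  | smul r x _ hx => exact hsmul r x hx

theorem evalFree_mul (f : X → Q) (a b : FreeNonUnitalNonAssocAlgebra K X) :
    evalFree K f (a * b) = br (K := K) (evalFree K f a) (evalFree K f b) := by
  refine free_induction K (p := fun a => evalFree K f (a * b) =
    br (K := K) (evalFree K f a) (evalFree K f b)) ?_ ?_ ?_ ?_ a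
  · simp
  · intro x y hx hy; simp only [add_mul, map_add, LinearMap.add_apply, hx, hy]
  · intro r x hx; simp only [smul_mul_assoc, map_smul, LinearMap.smul_apply, hx]
  intro s
  refine free_induction K (p := fun b => evalFree K f (MonoidAlgebra.single s 1 * b) =
    br (K := K) (evalFree K f (MonoidAlgebra.single s 1)) (evalFree K f b)) ?_ ?_ ?_ ?_ b
  · simp
  · intro x y hx hy; simp only [mul_add, map_add, hx, hy]
  · intro r x hx; simp only [mul_smul_comm, map_smul, hx]
  intro t
  rw [MonoidAlgebra.single_mul_single, evalFree_single, evalFree_single, evalFree_single, mul_one,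
    one_smul, one_smul, one_smul]
  rfl

theorem evalMonomial_mem (f : X → Q) (hf : ∀ x, f x ∈ grade (K := K) (A := Q) (d x)) :
    ∀ s : FreeMagma X, evalMonomial K f s ∈ grade (K := K) (A := Q) (monomialDegree d s)
  | .of x => hf x
  | .mul s t => br_mem (evalMonomial_mem f hf s) (evalMonomial_mem f hf t)

theorem evalFree_mem (f : X → Q) (hf : ∀ x, f x ∈ grade (K := K) (A := Q) (d x)) {i : ZMod 2}
    {a : FreeNonUnitalNonAssocAlgebra K X}
    (ha : a ∈ MonoidAlgebra.supported K K {s : FreeMagma X | monomialDegree d s = i}) :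
    evalFree K f a ∈ grade (K := K) (A := Q) i := by
  rw [MonoidAlgebra.supported_eq_span_single] at ha
  have h : Submodule.span K ((fun s : FreeMagma X =>
      (MonoidAlgebra.single s 1 : FreeNonUnitalNonAssocAlgebra K X)) ''
        {s | monomialDegree d s = i}) ≤ (grade (K := K) (A := Q) i).comap (evalFree K f) := by
    refine Submodule.span_le.2 ?_
    rintro _ ⟨s, hs, rfl⟩
    have hs' : monomialDegree d s = i := hs
    change evalFree K f (MonoidAlgebra.single s 1) ∈ grade (K := K) (A := Q) i
    rw [evalFree_single, one_smul, ← hs']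
    exact evalMonomial_mem K d f hf s
  exact h ha

/-- `evalFree` as a homomorphism of superalgebras. -/
def evalFreeHom (f : X → Q) (hf : ∀ x, f x ∈ grade (K := K) (A := Q) (d x)) :
    SuperHom K (FreeSuper K d) Q where
  toLinearMap := evalFree K f
  map_grade ha := evalFree_mem K d f hf ha
  map_br a b := evalFree_mul K f a b

theorem evalFreeHom_lieRel (f : X → Q) (hf : ∀ x, f x ∈ grade (K := K) (A := Q) (d x))
    {x : FreeSuper K d} (h : LieRel K d x) : evalFreeHom K d f hf x = 0 := by
  generalize evalFreeHom K d f hf = g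
  induction h with
  | skew ha hb =>
    rw [map_add, map_zsmul, g.map_br, g.map_br,
      LieSuperalgebra.skew (g.map_grade ha) (g.map_grade hb), neg_add_cancel]
  | jacobi ha hb hc =>
    rw [map_sub, map_sub, map_zsmul, g.map_br, g.map_br, g.map_br, g.map_br, g.map_br, g.map_br,
      LieSuperalgebra.jacobi (g.map_grade ha) (g.map_grade hb) (g.map_grade hc)]
    abel
  | even ha => rw [g.map_br, LieSuperalgebra.br_self_even (g.map_grade ha)]
  | odd ha => rw [g.map_br, g.map_br, LieSuperalgebra.br_br_self_odd (g.map_grade ha)]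
  | mul_left _ _ ih => rw [g.map_br, ih, map_zero]
  | mul_right _ _ ih => rw [g.map_br, ih, map_zero, LinearMap.zero_apply]

/-- The universal property of the free Lie superalgebra: a degree-preserving map from `X` to a Lie
superalgebra extends uniquely to a homomorphism. -/
theorem FreeLieSuper.existsUnique_lift (f : X → Q)
    (hf : ∀ x, f x ∈ grade (K := K) (A := Q) (d x)) :
    ∃! g : SuperHom K (FreeLieSuper K d) Q, ∀ x, g (FreeLieSuper.of K d x) = f x := by
  have hker : (lieIdeal K d).toSubmodule ≤ LinearMap.ker (evalFreeHom K d f hf).toLinearMap :=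
    Submodule.span_le.2 fun x hx => evalFreeHom_lieRel K d f hf hx
  refine ⟨⟨(lieIdeal K d).toSubmodule.liftQ (evalFreeHom K d f hf).toLinearMap hker, ?_, ?_⟩,
    fun x => ?_, ?_⟩
  · rintro i _ ⟨a, ha, rfl⟩
    exact (evalFreeHom K d f hf).map_grade ha
  · intro a b
    obtain ⟨a, rfl⟩ := Submodule.mkQ_surjective _ a
    obtain ⟨b, rfl⟩ := Submodule.mkQ_surjective _ b
    exact (evalFreeHom K d f hf).map_br a b
  · exact (evalFree_single K f (FreeMagma.of x) 1).trans (one_smul K _)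
  · rintro ⟨g, hg, hg'⟩ h
    congr 1
    refine LinearMap.ext fun a => ?_
    obtain ⟨a, rfl⟩ := Submodule.mkQ_surjective _ a
    change g ((lieIdeal K d).toSubmodule.mkQ a) = evalFree K f a
    have hs : ∀ s : FreeMagma X, g ((lieIdeal K d).toSubmodule.mkQ
        (show FreeSuper K d from MonoidAlgebra.single s 1)) = evalMonomial K f s := by
      intro s
      induction s with
      | ih1 x => exact h x
      | ih2 s t hs ht =>
        have e : (show FreeSuper K d from MonoidAlgebra.single (s * t) 1) =
            br (K := K) (show FreeSuper K d from MonoidAlgebra.single s 1)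
              (show FreeSuper K d from MonoidAlgebra.single t 1) := by
          refine Eq.symm ((MonoidAlgebra.single_mul_single s t (1 : K) 1).trans ?_)
          rw [mul_one]
        rw [e, ← GradedIdeal.mk_br]
        refine (hg' _ _).trans ?_
        rw [hs, ht]; rfl
    refine free_induction K (p := fun a : FreeNonUnitalNonAssocAlgebra K X =>
      g ((lieIdeal K d).toSubmodule.mkQ (show FreeSuper K d from a)) = evalFree K f a)
      ?_ ?_ ?_ ?_ a
    · exact (map_zero (g ∘ₗ (lieIdeal K d).toSubmodule.mkQ)).trans (map_zero _).symm
    · intro x y hx hy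
      refine (map_add (g ∘ₗ (lieIdeal K d).toSubmodule.mkQ) _ _).trans ?_
      rw [map_add, ← hx, ← hy]; rfl
    · intro r x hx
      refine (map_smul (g ∘ₗ (lieIdeal K d).toSubmodule.mkQ) _ _).trans ?_
      rw [map_smul, ← hx]; rfl
    · intro s
      rw [evalFree_single, one_smul]
      exact hs s

end Free

/-! ### Crossed modules and the non-abelian exterior product -/

/-- A crossed module of Lie superalgebras `bd : C → P`. -/
structure CrossedModule (K : Type u) (P : Type v) [CommRing K] [AddCommGroup P] [Module K P]
    [LieSuperalgebra K P] where
  carrier : Type w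
  [addCommGroup : AddCommGroup carrier]
  [module : Module K carrier]
  [lieSuperalgebra : LieSuperalgebra K carrier]
  bd : SuperHom K carrier P
  act : P →ₗ[K] carrier →ₗ[K] carrier
  act_mem : ∀ {i j : ZMod 2} {p : P} {m : carrier}, p ∈ grade (K := K) (A := P) i →
    m ∈ grade (K := K) (A := carrier) j → act p m ∈ grade (K := K) (A := carrier) (i + j)
  act_br : ∀ {i j : ZMod 2} {p q : P} (m : carrier), p ∈ grade (K := K) (A := P) i →
    q ∈ grade (K := K) (A := P) j →
    act (br (K := K) p q) m = act p (act q m) - ksign i j • act q (act p m)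
  act_deriv : ∀ {i j : ZMod 2} {p : P} {m : carrier} (m' : carrier),
    p ∈ grade (K := K) (A := P) i → m ∈ grade (K := K) (A := carrier) j →
    act p (br (K := K) m m') = br (K := K) (act p m) m' + ksign i j • br (K := K) m (act p m')
  bd_act : ∀ (p : P) (m : carrier), bd (act p m) = br (K := K) p (bd m)
  peiffer : ∀ m m' : carrier, act (bd m) m' = br (K := K) m m'

attribute [instance] CrossedModule.addCommGroup CrossedModule.module
  CrossedModule.lieSuperalgebra

section TensorGrading

variable (K : Type u) [CommRing K] (A : Type v) [AddCommGroup A] [Module K A] [SuperAlgebra K A]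
variable (B : Type w) [AddCommGroup B] [Module K B] [SuperAlgebra K B]

/-- The component of degree `k` of the graded module `A ⊗ B`. -/
def tensorGrade (k : ZMod 2) : Submodule K (A ⊗[K] B) :=
  Submodule.span K {t | ∃ i j : ZMod 2, ∃ a ∈ grade (K := K) (A := A) i,
    ∃ b ∈ grade (K := K) (A := B) j, i + j = k ∧ a ⊗ₜ[K] b = t}

variable {K A B}

theorem tmul_mem_tensorGrade {i j : ZMod 2} {a : A} {b : B} (ha : a ∈ grade (K := K) (A := A) i)
    (hb : b ∈ grade (K := K) (A := B) j) : a ⊗ₜ[K] b ∈ tensorGrade K A B (i + j) :=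
  Submodule.subset_span ⟨i, j, a, ha, b, hb, rfl, rfl⟩

theorem tensorGrade_induction {k : ZMod 2} {q : Submodule K (A ⊗[K] B)}
    (h : ∀ (i j : ZMod 2) (a : A) (b : B), a ∈ grade (K := K) (A := A) i →
      b ∈ grade (K := K) (A := B) j → i + j = k → a ⊗ₜ[K] b ∈ q) : tensorGrade K A B k ≤ q := by
  refine Submodule.span_le.2 ?_
  rintro _ ⟨i, j, a, ha, b, hb, hij, rfl⟩
  exact h i j a b ha hb hij

theorem tensor_induction {q : Submodule K (A ⊗[K] B)}
    (h : ∀ (i j : ZMod 2) (a : A) (b : B), a ∈ grade (K := K) (A := A) i →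
      b ∈ grade (K := K) (A := B) j → a ⊗ₜ[K] b ∈ q) (x : A ⊗[K] B) : x ∈ q := by
  induction x using TensorProduct.induction_on with
  | zero => exact q.zero_mem
  | add x y hx hy => exact q.add_mem hx hy
  | tmul a b =>
    refine homog_induction K (p := fun a => a ⊗ₜ[K] b ∈ q) ?_ ?_ a
    · intro x y hx hy
      rw [TensorProduct.add_tmul]; exact q.add_mem hx hy
    intro i a ha
    refine homog_induction K (p := fun b => a ⊗ₜ[K] b ∈ q) ?_ ?_ b
    · intro x y hx hy
      rw [TensorProduct.tmul_add]; exact q.add_mem hx hy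
    intro j b hb
    exact h i j a b ha hb

theorem isCompl_tensorGrade : IsCompl (tensorGrade K A B 0) (tensorGrade K A B 1) := by
  constructor
  · refine disjoint_of_projection (TensorProduct.map (proj K A 0) (proj K B 0) +
      TensorProduct.map (proj K A 1) (proj K B 1)) (fun x hx => ?_) (fun x hx => ?_)
    · refine tensorGrade_induction (q := LinearMap.eqLocus (TensorProduct.map (proj K A 0)
        (proj K B 0) + TensorProduct.map (proj K A 1) (proj K B 1)) LinearMap.id) ?_ hx
      intro i j a b ha hb hij
      rw [LinearMap.mem_eqLocus]
      rcases zmod_two_cases i with rfl | rfl <;> rcases zmod_two_cases j with rfl | rfl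
      · simp [proj_same ha, proj_same hb, proj_ne one_ne_zero ha]
      · simp at hij
      · simp at hij
      · simp [proj_same ha, proj_same hb, proj_ne zero_ne_one ha]
    · refine tensorGrade_induction (q := LinearMap.ker (TensorProduct.map (proj K A 0)
        (proj K B 0) + TensorProduct.map (proj K A 1) (proj K B 1))) ?_ hx
      intro i j a b ha hb hij
      rw [LinearMap.mem_ker]
      rcases zmod_two_cases i with rfl | rfl <;> rcases zmod_two_cases j with rfl | rfl
      · simp at hij
      · simp [proj_ne one_ne_zero ha, proj_ne zero_ne_one hb]
      · simp [proj_ne zero_ne_one ha, proj_ne one_ne_zero hb]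
      · simp at hij
  · rw [codisjoint_iff, eq_top_iff]
    rintro x -
    refine tensor_induction ?_ x
    intro i j a b ha hb
    have h := tmul_mem_tensorGrade (K := K) ha hb
    rcases zmod_two_cases (i + j) with e | e <;> rw [e] at h
    · exact Submodule.mem_sup_left h
    · exact Submodule.mem_sup_right h

end TensorGrading

namespace CrossedModule

variable {K : Type u} [CommRing K] {P : Type v} [AddCommGroup P] [Module K P] [LieSuperalgebra K P]
variable (C : CrossedModule.{u, v, w} K P)

/-- The linear map `C ⊗ P → C` with `m ⊗ n ↦ -(-1)^{|m||n|} ⁿm` for homogeneous `m`, `n`. -/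
def rightAct : C.carrier ⊗[K] P →ₗ[K] C.carrier :=
  TensorProduct.lift (-(∑ i : ZMod 2, ∑ j : ZMod 2,
    ksign i j • C.act.flip.compl₁₂ (proj K C.carrier i) (proj K P j)))

/-- The linear action of `P` on `C ⊗ P` with
`ᵖ(m ⊗ n) = ᵖm ⊗ n + (-1)^{|p||m|} m ⊗ [p, n]` for homogeneous `p`, `m`. -/
def tensorAct : P →ₗ[K] (C.carrier ⊗[K] P) →ₗ[K] (C.carrier ⊗[K] P) :=
  (LinearMap.rTensorHom P) ∘ₗ C.act +
    ∑ k : ZMod 2, ∑ i : ZMod 2, ksign k i •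
      ((LinearMap.lcomp K (C.carrier ⊗[K] P) (LinearMap.rTensor P (proj K C.carrier i))) ∘ₗ
        (LinearMap.lTensorHom C.carrier) ∘ₗ (br (K := K) (A := P)) ∘ₗ (proj K P k))

variable {C}

theorem rightAct_tmul {i j : ZMod 2} {m : C.carrier} {n : P}
    (hm : m ∈ grade (K := K) (A := C.carrier) i) (hn : n ∈ grade (K := K) (A := P) j) :
    C.rightAct (m ⊗ₜ[K] n) = -(ksign i j • C.act n m) := by
  simp only [rightAct, TensorProduct.lift.tmul, LinearMap.neg_apply, LinearMap.sum_apply,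
    LinearMap.smul_apply, LinearMap.compl₁₂_apply, LinearMap.flip_apply]
  rw [Finset.sum_eq_single i, Finset.sum_eq_single j, proj_same hm, proj_same hn]
  · intro j' _ hj; rw [proj_ne hj hn]; simp
  · simp
  · intro i' _ hi; rw [proj_ne hi hm]; simp
  · simp

theorem tensorAct_tmul {k i : ZMod 2} {p : P} {m : C.carrier} (n : P)
    (hp : p ∈ grade (K := K) (A := P) k) (hm : m ∈ grade (K := K) (A := C.carrier) i) :
    C.tensorAct p (m ⊗ₜ[K] n) =
      C.act p m ⊗ₜ[K] n + ksign k i • (m ⊗ₜ[K] br (K := K) p n) := by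
  simp only [tensorAct, LinearMap.add_apply, LinearMap.sum_apply,
    LinearMap.smul_apply, LinearMap.comp_apply, LinearMap.lcomp_apply, LinearMap.coe_rTensorHom,
    LinearMap.coe_lTensorHom, LinearMap.rTensor_tmul, LinearMap.lTensor_tmul]
  rw [Finset.sum_eq_single k, Finset.sum_eq_single i, proj_same hm, proj_same hp]
  · intro i' _ hi; rw [proj_ne hi hm]; simp
  · simp
  · intro k' _ hk; rw [proj_ne hk hp]; simp
  · simp

variable (C)

/-- The relations of the exterior product `C ∧ P` (of the crossed `P`-modules `C` and `P`, the
latter with the identity map), as elements of `C ⊗ P`.  The last relation says `[x, [x, x]] = 0`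
for odd `x`, where `[m ⊗ n, m' ⊗ n'] = -(-1)^{|m||n|} ⁿm ⊗ [bd m', n']`; it is a consequence of the
others when `3` is invertible in `K`. -/
inductive ExtRel : C.carrier ⊗[K] P → Prop
  | left {i j k : ZMod 2} {m m' : C.carrier} {n : P}
      (hm : m ∈ grade (K := K) (A := C.carrier) i) (hm' : m' ∈ grade (K := K) (A := C.carrier) j)
      (hn : n ∈ grade (K := K) (A := P) k) :
      ExtRel (br (K := K) m m' ⊗ₜ[K] n - m ⊗ₜ[K] br (K := K) (C.bd m') n
        + ksign i j • (m' ⊗ₜ[K] br (K := K) (C.bd m) n))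
  | right {i j k : ZMod 2} {m : C.carrier} {n n' : P}
      (hm : m ∈ grade (K := K) (A := C.carrier) i) (hn : n ∈ grade (K := K) (A := P) j)
      (hn' : n' ∈ grade (K := K) (A := P) k) :
      ExtRel (m ⊗ₜ[K] br (K := K) n n' - ksign k (i + j) • (C.act n' m ⊗ₜ[K] n)
        + ksign i j • (C.act n m ⊗ₜ[K] n'))
  | swap {i j : ZMod 2} {m m' : C.carrier} (hm : m ∈ grade (K := K) (A := C.carrier) i)
      (hm' : m' ∈ grade (K := K) (A := C.carrier) j) :
      ExtRel (m ⊗ₜ[K] C.bd m' + ksign i j • (m' ⊗ₜ[K] C.bd m))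
  | even {m : C.carrier} (hm : m ∈ grade (K := K) (A := C.carrier) 0) :
      ExtRel (m ⊗ₜ[K] C.bd m)
  | odd {x : C.carrier ⊗[K] P} (hx : x ∈ tensorGrade K C.carrier P 1) :
      ExtRel (C.rightAct x ⊗ₜ[K] br (K := K) (C.bd (C.rightAct x)) (C.bd (C.rightAct x)))

/-- The submodule of `C ⊗ P` spanned by the relations. -/
def extRelations : Submodule K (C.carrier ⊗[K] P) := Submodule.span K {t | C.ExtRel t}

/-- The underlying module of the exterior product `C ∧ P`. -/
abbrev ExtCarrier : Type (max w v) := (C.carrier ⊗[K] P) ⧸ C.extRelations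

variable {C}

theorem ExtRel.left_mem {i j : ZMod 2} {m m' : C.carrier} (n : P)
      (hm : m ∈ grade (K := K) (A := C.carrier) i) (hm' : m' ∈ grade (K := K) (A := C.carrier) j) :
      (br (K := K) m m' ⊗ₜ[K] n - m ⊗ₜ[K] br (K := K) (C.bd m') n
        + ksign i j • (m' ⊗ₜ[K] br (K := K) (C.bd m) n)) ∈ C.extRelations := by
  refine homog_induction K (p := fun n => (br (K := K) m m' ⊗ₜ[K] n
    - m ⊗ₜ[K] br (K := K) (C.bd m') n
    + ksign i j • (m' ⊗ₜ[K] br (K := K) (C.bd m) n)) ∈ C.extRelations) ?_ ?_ n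
  · intro x y hx hy
    convert add_mem hx hy using 1
    simp only [TensorProduct.tmul_add, map_add, smul_add]; abel
  · intro k n hn
    exact Submodule.subset_span (ExtRel.left hm hm' hn)

theorem ExtRel.right_mem {i j k : ZMod 2} {m : C.carrier} {n n' : P}
      (hm : m ∈ grade (K := K) (A := C.carrier) i) (hn : n ∈ grade (K := K) (A := P) j)
      (hn' : n' ∈ grade (K := K) (A := P) k) :
      (m ⊗ₜ[K] br (K := K) n n' - ksign k (i + j) • (C.act n' m ⊗ₜ[K] n)
        + ksign i j • (C.act n m ⊗ₜ[K] n')) ∈ C.extRelations :=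
  Submodule.subset_span (ExtRel.right hm hn hn')

theorem ExtRel.swap_mem {i j : ZMod 2} {m m' : C.carrier}
      (hm : m ∈ grade (K := K) (A := C.carrier) i)
      (hm' : m' ∈ grade (K := K) (A := C.carrier) j) :
      (m ⊗ₜ[K] C.bd m' + ksign i j • (m' ⊗ₜ[K] C.bd m)) ∈ C.extRelations :=
  Submodule.subset_span (ExtRel.swap hm hm')

theorem rightAct_mem {k : ZMod 2} {x : C.carrier ⊗[K] P} (hx : x ∈ tensorGrade K C.carrier P k) :
    C.rightAct x ∈ grade (K := K) (A := C.carrier) k := by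
  refine tensorGrade_induction (q := (grade (K := K) (A := C.carrier) k).comap C.rightAct) ?_ hx
  rintro i j m n hm hn rfl
  change C.rightAct _ ∈ grade (K := K) (A := C.carrier) (i + j)
  rw [rightAct_tmul hm hn, add_comm]
  exact neg_mem (zsmul_mem (C.act_mem hn hm) _)

theorem jacobi' {i j : ZMod 2} {a b : P} (ha : a ∈ grade (K := K) (A := P) i)
    (hb : b ∈ grade (K := K) (A := P) j) (c : P) :
    br (K := K) a (br (K := K) b c) = br (K := K) (br (K := K) a b) c
      + ksign i j • br (K := K) b (br (K := K) a c) := by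
  refine homog_induction K (p := fun c => br (K := K) a (br (K := K) b c) =
    br (K := K) (br (K := K) a b) c + ksign i j • br (K := K) b (br (K := K) a c)) ?_ ?_ c
  · intro x y hx hy
    simp only [map_add, hx, hy, smul_add]; abel
  · intro k c hc
    exact LieSuperalgebra.jacobi ha hb hc

theorem rightAct_extRel {t : C.carrier ⊗[K] P} (h : C.ExtRel t) : C.rightAct t = 0 := by
  induction h with
  | @left i j k m m' n hm hm' hn =>
    have h1 := C.act_deriv m' hn hm
    have h2 := C.act_br m (C.bd.map_grade hm') hn
    have h3 := C.act_br m' (C.bd.map_grade hm) hn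
    have h4 := C.act_deriv m hn hm'
    have h5 := LieSuperalgebra.skew hm' (C.act_mem hn hm)
    have h6 := LieSuperalgebra.skew (C.act_mem hn hm') hm
    simp only [C.peiffer] at h2 h3
    rw [map_add, map_sub, map_zsmul, rightAct_tmul (br_mem hm hm') hn,
      rightAct_tmul hm (br_mem (C.bd.map_grade hm') hn),
      rightAct_tmul hm' (br_mem (C.bd.map_grade hm) hn), h2, h3, h4, h1, h5, h6]
    rcases zmod_two_cases i with rfl | rfl <;> rcases zmod_two_cases j with rfl | rfl <;>
      rcases zmod_two_cases k with rfl | rfl <;> simp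
  | @right i j k m n n' hm hn hn' =>
    rw [map_add, map_sub, map_zsmul, map_zsmul, rightAct_tmul hm (br_mem hn hn'),
      rightAct_tmul (C.act_mem hn' hm) hn, rightAct_tmul (C.act_mem hn hm) hn',
      C.act_br m hn hn']
    rcases zmod_two_cases i with rfl | rfl <;> rcases zmod_two_cases j with rfl | rfl <;>
      rcases zmod_two_cases k with rfl | rfl <;> simp
  | @swap i j m m' hm hm' =>
    rw [map_add, map_zsmul, rightAct_tmul hm (C.bd.map_grade hm'),
      rightAct_tmul hm' (C.bd.map_grade hm), C.peiffer, C.peiffer, LieSuperalgebra.skew hm' hm]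
    rcases zmod_two_cases i with rfl | rfl <;> rcases zmod_two_cases j with rfl | rfl <;> simp
  | even hm =>
    rw [rightAct_tmul hm (C.bd.map_grade hm), C.peiffer, LieSuperalgebra.br_self_even hm]
    simp
  | @odd x hx =>
    have hy := rightAct_mem hx
    have hyy := C.bd.map_grade hy
    rw [rightAct_tmul hy (br_mem hyy hyy), ← C.bd.map_br, C.peiffer,
      LieSuperalgebra.skew (br_mem hy hy) hy, LieSuperalgebra.br_br_self_odd hy]
    simp

theorem rightAct_extRelations {t : C.carrier ⊗[K] P} (h : t ∈ C.extRelations) :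
    C.rightAct t = 0 := by
  have : C.extRelations ≤ LinearMap.ker C.rightAct :=
    Submodule.span_le.2 fun t ht => rightAct_extRel ht
  exact this h

theorem tensorAct_mem {l k : ZMod 2} {p : P} {x : C.carrier ⊗[K] P}
    (hp : p ∈ grade (K := K) (A := P) l) (hx : x ∈ tensorGrade K C.carrier P k) :
    C.tensorAct p x ∈ tensorGrade K C.carrier P (l + k) := by
  refine tensorGrade_induction (q := (tensorGrade K C.carrier P (l + k)).comap (C.tensorAct p))
    ?_ hx
  rintro i j m n hm hn rfl
  change C.tensorAct p _ ∈ tensorGrade K C.carrier P (l + (i + j))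
  rw [tensorAct_tmul n hp hm]
  refine add_mem ?_ (zsmul_mem ?_ _)
  · rw [← add_assoc]; exact tmul_mem_tensorGrade (C.act_mem hp hm) hn
  · rw [add_left_comm]; exact tmul_mem_tensorGrade hm (br_mem hp hn)

theorem rightAct_tensorAct (p : P) (x : C.carrier ⊗[K] P) :
    C.rightAct (C.tensorAct p x) = C.act p (C.rightAct x) := by
  refine homog_induction K (p := fun p => C.rightAct (C.tensorAct p x) = C.act p (C.rightAct x))
    ?_ ?_ p
  · intro p q hp hq
    simp only [map_add, LinearMap.add_apply, hp, hq]
  intro l p hp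
  refine tensor_induction
    (q := LinearMap.eqLocus (C.rightAct ∘ₗ C.tensorAct p) (C.act p ∘ₗ C.rightAct)) ?_ x
  intro i j m n hm hn
  rw [LinearMap.mem_eqLocus, LinearMap.comp_apply, LinearMap.comp_apply, tensorAct_tmul n hp hm,
    map_add, map_zsmul, rightAct_tmul (C.act_mem hp hm) hn, rightAct_tmul hm (br_mem hp hn),
    rightAct_tmul hm hn, C.act_br m hp hn]
  rcases zmod_two_cases i with rfl | rfl <;> rcases zmod_two_cases j with rfl | rfl <;>
    rcases zmod_two_cases l with rfl | rfl <;> simp <;> abel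

set_option linter.unusedSimpArgs false in
theorem tensorAct_extRel {l : ZMod 2} {p : P} (hp : p ∈ grade (K := K) (A := P) l)
    {t : C.carrier ⊗[K] P} (h : C.ExtRel t) : C.tensorAct p t ∈ C.extRelations := by
  induction h with
  | @left i j _ m m' n hm hm' _ =>
    have h1 := ExtRel.left_mem n (C.act_mem hp hm) hm'
    have h2 := ExtRel.left_mem n hm (C.act_mem hp hm')
    have h3 := ExtRel.left_mem (br (K := K) p n) hm hm'
    have h := add_mem (add_mem h1 (zsmul_mem h2 (ksign l i))) (zsmul_mem h3 (ksign l (i + j)))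
    convert h using 1
    rw [map_add, map_sub, map_zsmul, tensorAct_tmul _ hp (br_mem hm hm'), tensorAct_tmul _ hp hm,
      tensorAct_tmul _ hp hm', C.act_deriv _ hp hm, jacobi' hp (C.bd.map_grade hm'),
      jacobi' hp (C.bd.map_grade hm), C.bd_act, C.bd_act]
    rcases zmod_two_cases i with rfl | rfl <;> rcases zmod_two_cases j with rfl | rfl <;>
      rcases zmod_two_cases l with rfl | rfl <;> simp [TensorProduct.neg_tmul, TensorProduct.tmul_neg, TensorProduct.add_tmul,
        TensorProduct.sub_tmul, TensorProduct.tmul_add, TensorProduct.tmul_sub] <;> abel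
  | @right i j k m n n' hm hn hn' =>
    have h1 := ExtRel.right_mem (C.act_mem hp hm) hn hn'
    have h2 := ExtRel.right_mem hm (br_mem hp hn) hn'
    have h3 := ExtRel.right_mem hm hn (br_mem hp hn')
    have h := add_mem (add_mem h1 (zsmul_mem h2 (ksign l i))) (zsmul_mem h3 (ksign l (i + j)))
    convert h using 1
    rw [map_add, map_sub, map_zsmul, map_zsmul, tensorAct_tmul _ hp hm,
      tensorAct_tmul _ hp (C.act_mem hn' hm), tensorAct_tmul _ hp (C.act_mem hn hm),
      jacobi' hp hn, C.act_br m hp hn, C.act_br m hp hn']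
    rcases zmod_two_cases i with rfl | rfl <;> rcases zmod_two_cases j with rfl | rfl <;>
      rcases zmod_two_cases l with rfl | rfl <;> rcases zmod_two_cases k with rfl | rfl <;>
      simp [TensorProduct.neg_tmul, TensorProduct.tmul_neg, TensorProduct.add_tmul,
        TensorProduct.sub_tmul, TensorProduct.tmul_add, TensorProduct.tmul_sub] <;> abel
  | @swap i j m m' hm hm' =>
    have h1 := ExtRel.swap_mem (C.act_mem hp hm) hm'
    have h2 := ExtRel.swap_mem hm (C.act_mem hp hm')
    have h := add_mem h1 (zsmul_mem h2 (ksign l i))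
    convert h using 1
    rw [map_add, map_zsmul, tensorAct_tmul _ hp hm, tensorAct_tmul _ hp hm', C.bd_act, C.bd_act]
    rcases zmod_two_cases i with rfl | rfl <;> rcases zmod_two_cases j with rfl | rfl <;>
      rcases zmod_two_cases l with rfl | rfl <;> simp [TensorProduct.neg_tmul, TensorProduct.tmul_neg, TensorProduct.add_tmul,
        TensorProduct.sub_tmul, TensorProduct.tmul_add, TensorProduct.tmul_sub] <;> abel
  | @even m hm =>
    have h := ExtRel.swap_mem hm (C.act_mem hp hm)
    convert h using 1
    rw [tensorAct_tmul _ hp hm, C.bd_act]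
    simp [add_comm]
  | @odd x hx =>
    have hy := rightAct_mem hx
    generalize C.rightAct x = y at hy
    have hn := C.bd.map_grade hy
    have h1 := ExtRel.swap_mem (C.act_mem hp hy) (br_mem hy hy)
    have h2 := ExtRel.left_mem (C.bd (C.act p y)) hy hy
    have h := sub_mem h1 h2
    convert h using 1
    have hq := C.bd.map_grade (C.act_mem hp hy)
    rw [tensorAct_tmul _ hp hy, jacobi' hp hn, ← C.bd_act p y, LieSuperalgebra.skew hq hn,
      C.bd.map_br]
    rcases zmod_two_cases l with rfl | rfl <;> simp [TensorProduct.neg_tmul, TensorProduct.tmul_neg, TensorProduct.add_tmul,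
      TensorProduct.sub_tmul, TensorProduct.tmul_add, TensorProduct.tmul_sub] <;> abel

theorem tensorAct_extRelations (p : P) {t : C.carrier ⊗[K] P} (h : t ∈ C.extRelations) :
    C.tensorAct p t ∈ C.extRelations := by
  refine homog_induction K (p := fun p => C.tensorAct p t ∈ C.extRelations) ?_ ?_ p
  · intro x y hx hy
    rw [map_add, LinearMap.add_apply]; exact add_mem hx hy
  · intro l p hp
    have : C.extRelations ≤ C.extRelations.comap (C.tensorAct p) :=
      Submodule.span_le.2 fun t ht => tensorAct_extRel hp ht
    exact this h

theorem ExtRel.mem_tensorGrade {t : C.carrier ⊗[K] P} (h : C.ExtRel t) :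
    ∃ k, t ∈ tensorGrade K C.carrier P k := by
  cases h with
  | @left i j k m m' n hm hm' hn =>
    refine ⟨i + j + k, add_mem (sub_mem (tmul_mem_tensorGrade (br_mem hm hm') hn) ?_)
      (zsmul_mem ?_ _)⟩
    · rw [add_assoc]
      exact tmul_mem_tensorGrade hm (br_mem (C.bd.map_grade hm') hn)
    · rw [show i + j + k = j + (i + k) by ring]
      exact tmul_mem_tensorGrade hm' (br_mem (C.bd.map_grade hm) hn)
  | @right i j k m n n' hm hn hn' =>
    refine ⟨i + (j + k), add_mem (sub_mem (tmul_mem_tensorGrade hm (br_mem hn hn'))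
      (zsmul_mem ?_ _)) (zsmul_mem ?_ _)⟩
    · rw [show i + (j + k) = k + i + j by ring]
      exact tmul_mem_tensorGrade (C.act_mem hn' hm) hn
    · rw [show i + (j + k) = j + i + k by ring]
      exact tmul_mem_tensorGrade (C.act_mem hn hm) hn'
  | @swap i j m m' hm hm' =>
    refine ⟨i + j, add_mem (tmul_mem_tensorGrade hm (C.bd.map_grade hm')) (zsmul_mem ?_ _)⟩
    rw [add_comm]
    exact tmul_mem_tensorGrade hm' (C.bd.map_grade hm)
  | even hm => exact ⟨_, tmul_mem_tensorGrade hm (C.bd.map_grade hm)⟩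
  | odd hx =>
    have hy := rightAct_mem hx
    have hn := C.bd.map_grade hy
    exact ⟨_, tmul_mem_tensorGrade hy (br_mem hn hn)⟩

variable (C)

/-- The map `C ∧ P → C` with `m ∧ n ↦ -(-1)^{|m||n|} ⁿm` for homogeneous `m`, `n`. -/
def extRightAct : C.ExtCarrier →ₗ[K] C.carrier :=
  C.extRelations.liftQ C.rightAct fun _ ht => rightAct_extRelations ht

variable {C}

@[simp] theorem extRightAct_mkQ (t : C.carrier ⊗[K] P) :
    C.extRightAct (C.extRelations.mkQ t) = C.rightAct t := rfl

/-- The exterior product `C ∧ P` is a superalgebra with the product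
`[m ∧ n, m' ∧ n'] = -(-1)^{|m||n|} ⁿm ∧ [bd m', n']`. -/
instance instExtSuper : SuperAlgebra K C.ExtCarrier where
  grade k := (tensorGrade K C.carrier P k).map C.extRelations.mkQ
  isCompl := isCompl_map_mkQ isCompl_tensorGrade (homog_span (by
    intro t ht
    obtain ⟨k, hk⟩ := ExtRel.mem_tensorGrade ht
    rcases zmod_two_cases k with rfl | rfl
    · exact Or.inl hk
    · exact Or.inr hk))
  br := LinearMap.mk₂ K
    (fun x y => C.extRelations.mkQ (C.extRightAct x ⊗ₜ[K] C.bd (C.extRightAct y)))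
    (by intros; simp [TensorProduct.add_tmul])
    (by intros; rw [map_smul, ← TensorProduct.smul_tmul', map_smul])
    (by intros; simp [TensorProduct.tmul_add]) (by intros; simp)
  br_mem := by
    rintro i j _ _ ⟨x, hx, rfl⟩ ⟨y, hy, rfl⟩
    exact ⟨_, tmul_mem_tensorGrade (rightAct_mem hx) (C.bd.map_grade (rightAct_mem hy)), rfl⟩

theorem ext_br (x y : C.ExtCarrier) : br (K := K) x y =
    C.extRelations.mkQ (C.extRightAct x ⊗ₜ[K] C.bd (C.extRightAct y)) := rfl

theorem extRightAct_mem {k : ZMod 2} {x : C.ExtCarrier}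
    (hx : x ∈ grade (K := K) (A := C.ExtCarrier) k) :
    C.extRightAct x ∈ grade (K := K) (A := C.carrier) k := by
  obtain ⟨x, hx, rfl⟩ := hx
  exact rightAct_mem hx

theorem rightAct_tmul_bd (a b : C.carrier) :
    C.rightAct (a ⊗ₜ[K] C.bd b) = br (K := K) a b := by
  refine homog_induction K (p := fun a => C.rightAct (a ⊗ₜ[K] C.bd b) = br (K := K) a b) ?_ ?_ a
  · intro x y hx hy
    rw [TensorProduct.add_tmul, map_add, hx, hy, map_add, LinearMap.add_apply]
  intro i a ha
  refine homog_induction K (p := fun b => C.rightAct (a ⊗ₜ[K] C.bd b) = br (K := K) a b) ?_ ?_ b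
  · intro x y hx hy
    rw [map_add, TensorProduct.tmul_add, map_add, hx, hy, map_add]
  intro j b hb
  rw [rightAct_tmul ha (C.bd.map_grade hb), C.peiffer, LieSuperalgebra.skew ha hb]

theorem extRightAct_br (x y : C.ExtCarrier) :
    C.extRightAct (br (K := K) x y) = br (K := K) (C.extRightAct x) (C.extRightAct y) := by
  rw [ext_br, extRightAct_mkQ, rightAct_tmul_bd]

theorem mkQ_eq_zero {t : C.carrier ⊗[K] P} (h : t ∈ C.extRelations) :
    C.extRelations.mkQ t = 0 := (Submodule.Quotient.mk_eq_zero _).2 h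

/-- The exterior product `C ∧ P` is a Lie superalgebra. -/
instance instExtLie : LieSuperalgebra K C.ExtCarrier where
  toSuperAlgebra := instExtSuper
  skew := by
    intro i j x y hx hy
    have h := mkQ_eq_zero (ExtRel.swap_mem (extRightAct_mem hx) (extRightAct_mem hy))
    rw [map_add, map_zsmul] at h
    exact eq_neg_of_add_eq_zero_left h
  jacobi := by
    intro i j k x y z hx hy hz
    have h := mkQ_eq_zero (ExtRel.left_mem (C.bd (C.extRightAct z)) (extRightAct_mem hx)
      (extRightAct_mem hy))
    rw [map_add, map_sub, map_zsmul] at h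
    rw [ext_br x, ext_br (br (K := K) x y), ext_br y (br (K := K) x z), extRightAct_br,
      extRightAct_br, extRightAct_br, C.bd.map_br, C.bd.map_br]
    rw [sub_add_eq_add_sub, sub_eq_zero] at h
    exact h.symm
  br_self_even := by
    intro x hx
    exact mkQ_eq_zero (Submodule.subset_span (ExtRel.even (extRightAct_mem hx)))
  br_br_self_odd := by
    rintro _ ⟨x, hx, rfl⟩
    rw [ext_br, extRightAct_br, C.bd.map_br]
    exact mkQ_eq_zero (Submodule.subset_span (ExtRel.odd hx))

variable (C)

/-- The action of `P` on `C ∧ P`, with `ᵖ(m ∧ n) = ᵖm ∧ n + (-1)^{|p||m|} m ∧ [p, n]` for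
homogeneous `p`, `m`. -/
def extAct : P →ₗ[K] C.ExtCarrier →ₗ[K] C.ExtCarrier :=
  LinearMap.mk₂ K
    (fun p x => Submodule.mapQ C.extRelations C.extRelations (C.tensorAct p)
      (fun _ ht => tensorAct_extRelations p ht) x)
    (by
      intro p q x
      obtain ⟨x, rfl⟩ := Submodule.mkQ_surjective _ x
      simp [Submodule.mapQ_apply])
    (by
      intro r p x
      obtain ⟨x, rfl⟩ := Submodule.mkQ_surjective _ x
      simp [Submodule.mapQ_apply])
    (by intros; simp) (by intros; simp)

variable {C}

theorem extAct_mkQ (p : P) (t : C.carrier ⊗[K] P) :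
    C.extAct p (C.extRelations.mkQ t) = C.extRelations.mkQ (C.tensorAct p t) := rfl

theorem extRightAct_extAct (p : P) (x : C.ExtCarrier) :
    C.extRightAct (C.extAct p x) = C.act p (C.extRightAct x) := by
  obtain ⟨x, rfl⟩ := Submodule.mkQ_surjective _ x
  exact rightAct_tensorAct p x

variable (C)

/-- The exterior product `C ∧ P` of a crossed `P`-module `C` with `P`, as a crossed `P`-module.
The map to `P` sends `m ∧ n` to `[bd m, n]`. -/
def extProd : CrossedModule.{u, v, max w v} K P where
  carrier := C.ExtCarrier
  bd :=
    { toLinearMap := C.bd.toLinearMap ∘ₗ C.extRightAct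
      map_grade := fun h => C.bd.map_grade (extRightAct_mem h)
      map_br := fun x y => by
        rw [LinearMap.comp_apply, extRightAct_br, C.bd.map_br]; rfl }
  act := C.extAct
  act_mem := by
    rintro i j p _ hp ⟨x, hx, rfl⟩
    exact ⟨_, tensorAct_mem hp hx, rfl⟩
  act_br := by
    intro i j p q x hp hq
    obtain ⟨x, rfl⟩ := Submodule.mkQ_surjective _ x
    simp only [extAct_mkQ]
    rw [← map_zsmul, ← map_sub]
    congr 1
    refine tensor_induction (q := LinearMap.eqLocus (C.tensorAct (br (K := K) p q))
      (C.tensorAct p ∘ₗ C.tensorAct q - ksign i j • (C.tensorAct q ∘ₗ C.tensorAct p))) ?_ x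
    intro k l m n hm hn
    rw [LinearMap.mem_eqLocus, tensorAct_tmul _ (br_mem hp hq) hm, LinearMap.sub_apply,
      LinearMap.smul_apply, LinearMap.comp_apply, LinearMap.comp_apply,
      tensorAct_tmul _ hp hm, tensorAct_tmul _ hq hm, map_add, map_add, map_zsmul, map_zsmul,
      tensorAct_tmul _ hp hm, tensorAct_tmul _ hq hm, tensorAct_tmul _ hp (C.act_mem hq hm),
      tensorAct_tmul _ hq (C.act_mem hp hm), C.act_br m hp hq, jacobi' hp hq,
      TensorProduct.sub_tmul]
    rcases zmod_two_cases i with rfl | rfl <;> rcases zmod_two_cases j with rfl | rfl <;>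
      rcases zmod_two_cases k with rfl | rfl <;>
      simp [TensorProduct.tmul_add, TensorProduct.tmul_neg, TensorProduct.neg_tmul] <;> abel
  act_deriv := by
    intro i j p x y hp hx
    rw [ext_br, ext_br, ext_br, extAct_mkQ, tensorAct_tmul _ hp (extRightAct_mem hx), map_add,
      map_zsmul, extRightAct_extAct, extRightAct_extAct, C.bd_act]
  bd_act := by
    intro p x
    change C.bd (C.extRightAct (C.extAct p x)) = br (K := K) p (C.bd (C.extRightAct x))
    rw [extRightAct_extAct, C.bd_act]
  peiffer := by
    intro x y
    change C.extAct (C.bd (C.extRightAct x)) y = br (K := K) x y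
    rw [ext_br]
    refine homog_induction K (p := fun x => C.extAct (C.bd (C.extRightAct x)) y =
      C.extRelations.mkQ (C.extRightAct x ⊗ₜ[K] C.bd (C.extRightAct y))) ?_ ?_ x
    · intro x x' hx hx'
      simp only [map_add, LinearMap.add_apply, hx, hx', TensorProduct.add_tmul]
    intro i x hx
    have ha := extRightAct_mem hx
    generalize C.extRightAct x = a at ha
    obtain ⟨y, rfl⟩ := Submodule.mkQ_surjective _ y
    rw [extAct_mkQ, extRightAct_mkQ]
    refine tensor_induction (q := LinearMap.eqLocus
      (C.extRelations.mkQ ∘ₗ C.tensorAct (C.bd a))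
      (C.extRelations.mkQ ∘ₗ TensorProduct.mk K C.carrier P a ∘ₗ C.bd.toLinearMap ∘ₗ
        C.rightAct)) ?_ y
    intro j k m n hm hn
    have h := mkQ_eq_zero (ExtRel.left_mem n ha hm)
    rw [LinearMap.mem_eqLocus, LinearMap.comp_apply, tensorAct_tmul _ (C.bd.map_grade ha) hm,
      C.peiffer]
    simp only [LinearMap.comp_apply, TensorProduct.mk_apply]
    rw [rightAct_tmul hm hn, map_neg, map_zsmul, C.bd_act,
      ← LieSuperalgebra.skew (C.bd.map_grade hm) hn]
    rw [map_add, map_sub, sub_add_eq_add_sub, sub_eq_zero, ← map_add] at h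
    exact h

/-- The element `m ∧ n` of `C ∧ P`. -/
def wedge (m : C.carrier) (n : P) : C.extProd.carrier := C.extRelations.mkQ (m ⊗ₜ[K] n)

theorem bd_wedge (m : C.carrier) (n : P) :
    C.extProd.bd (C.wedge m n) = br (K := K) (C.bd m) n := by
  change C.bd (C.rightAct (m ⊗ₜ[K] n)) = br (K := K) (C.bd m) n
  refine homog_induction K (p := fun m => C.bd (C.rightAct (m ⊗ₜ[K] n)) =
    br (K := K) (C.bd m) n) ?_ ?_ m
  · intro x y hx hy
    simp only [TensorProduct.add_tmul, map_add, LinearMap.add_apply, hx, hy]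
  intro i m hm
  refine homog_induction K (p := fun n => C.bd (C.rightAct (m ⊗ₜ[K] n)) =
    br (K := K) (C.bd m) n) ?_ ?_ n
  · intro x y hx hy
    simp only [TensorProduct.tmul_add, map_add, hx, hy]
  intro j n hn
  rw [rightAct_tmul hm hn, map_neg, map_zsmul, C.bd_act,
    ← LieSuperalgebra.skew (C.bd.map_grade hm) hn]

/-- The universal property of the exterior product: a bilinear map `ρ : C × P → Q` of degree `0`
to a Lie superalgebra which satisfies the identities of a Lie super exterior pairing factors
uniquely through a homomorphism `C ∧ P → Q`. -/
theorem extProd_universal {Q : Type w₁} [AddCommGroup Q] [Module K Q] [LieSuperalgebra K Q]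
    (ρ : C.carrier →ₗ[K] P →ₗ[K] Q)
    (hρ : ∀ {i j : ZMod 2} {m : C.carrier} {n : P}, m ∈ grade (K := K) (A := C.carrier) i →
      n ∈ grade (K := K) (A := P) j → ρ m n ∈ grade (K := K) (A := Q) (i + j))
    (h1 : ∀ {i j : ZMod 2} {m m' : C.carrier} (n : P),
      m ∈ grade (K := K) (A := C.carrier) i → m' ∈ grade (K := K) (A := C.carrier) j →
      ρ (br (K := K) m m') n =
        ρ m (br (K := K) (C.bd m') n) - ksign i j • ρ m' (br (K := K) (C.bd m) n))
    (h2 : ∀ {i j k : ZMod 2} {m : C.carrier} {n n' : P},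
      m ∈ grade (K := K) (A := C.carrier) i → n ∈ grade (K := K) (A := P) j →
      n' ∈ grade (K := K) (A := P) k →
      ρ m (br (K := K) n n') =
        ksign k (i + j) • ρ (C.act n' m) n - ksign i j • ρ (C.act n m) n')
    (h3 : ∀ {i j : ZMod 2} {m : C.carrier} {n : P} (m' : C.carrier) (n' : P),
      m ∈ grade (K := K) (A := C.carrier) i → n ∈ grade (K := K) (A := P) j →
      br (K := K) (ρ m n) (ρ m' n') = -(ksign i j • ρ (C.act n m) (br (K := K) (C.bd m') n')))
    (h4 : ∀ {i j : ZMod 2} {m m' : C.carrier}, m ∈ grade (K := K) (A := C.carrier) i →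
      m' ∈ grade (K := K) (A := C.carrier) j → ρ m (C.bd m') + ksign i j • ρ m' (C.bd m) = 0)
    (h5 : ∀ {m : C.carrier}, m ∈ grade (K := K) (A := C.carrier) 0 → ρ m (C.bd m) = 0) :
    ∃! f : SuperHom K C.extProd.carrier Q, ∀ m n, f (C.wedge m n) = ρ m n := by
  set F : C.carrier ⊗[K] P →ₗ[K] Q := TensorProduct.lift ρ with hF
  have hFt : ∀ m n, F (m ⊗ₜ[K] n) = ρ m n := fun m n => TensorProduct.lift.tmul m n
  have key : ∀ x y, F (C.rightAct x ⊗ₜ[K] C.bd (C.rightAct y)) = br (K := K) (F x) (F y) := by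
    intro x y
    refine tensor_induction (q := LinearMap.eqLocus
      (F ∘ₗ (TensorProduct.mk K C.carrier P).flip (C.bd (C.rightAct y)) ∘ₗ C.rightAct)
      ((br (K := K) (A := Q)).flip (F y) ∘ₗ F)) ?_ x
    intro i j m n hm hn
    refine tensor_induction (q := LinearMap.eqLocus
      (F ∘ₗ TensorProduct.mk K C.carrier P (C.rightAct (m ⊗ₜ[K] n)) ∘ₗ C.bd.toLinearMap ∘ₗ
        C.rightAct) (br (K := K) (A := Q) (F (m ⊗ₜ[K] n)) ∘ₗ F)) ?_ y
    intro k l m' n' hm' hn'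
    simp only [LinearMap.mem_eqLocus, LinearMap.comp_apply, TensorProduct.mk_apply]
    rw [hFt, hFt, hFt, h3 m' n' hm hn, rightAct_tmul hm hn, rightAct_tmul hm' hn', map_neg,
      LinearMap.neg_apply, map_zsmul, LinearMap.smul_apply, map_neg, map_zsmul, C.bd_act,
      ← LieSuperalgebra.skew (C.bd.map_grade hm') hn']
  have hgr : ∀ {k : ZMod 2} {x : C.carrier ⊗[K] P}, x ∈ tensorGrade K C.carrier P k →
      F x ∈ grade (K := K) (A := Q) k := by
    intro k x hx
    refine tensorGrade_induction (q := (grade (K := K) (A := Q) k).comap F) ?_ hx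
    rintro i j m n hm hn rfl
    change F (m ⊗ₜ[K] n) ∈ grade (K := K) (A := Q) (i + j)
    rw [hFt]; exact hρ hm hn
  have hker : C.extRelations ≤ LinearMap.ker F := by
    refine Submodule.span_le.2 ?_
    intro t ht
    change F t = 0
    cases ht with
    | @left i j k m m' n hm hm' hn =>
      rw [map_add, map_sub, map_zsmul, hFt, hFt, hFt, h1 n hm hm']; abel
    | @right i j k m n n' hm hn hn' =>
      rw [map_add, map_sub, map_zsmul, map_zsmul, hFt, hFt, hFt, h2 hm hn hn']; abel
    | @swap i j m m' hm hm' => rw [map_add, map_zsmul, hFt, hFt, h4 hm hm']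
    | even hm => rw [hFt, h5 hm]
    | @odd x hx =>
      rw [← C.bd.map_br, ← rightAct_tmul_bd, key, key, LieSuperalgebra.br_br_self_odd (hgr hx)]
  refine ⟨⟨C.extRelations.liftQ F hker, ?_, ?_⟩, fun m n => hFt m n, ?_⟩
  · rintro k _ ⟨x, hx, rfl⟩
    exact hgr hx
  · intro x y
    obtain ⟨x, rfl⟩ := Submodule.mkQ_surjective _ x
    obtain ⟨y, rfl⟩ := Submodule.mkQ_surjective _ y
    exact key x y
  · rintro ⟨g, hg, hg'⟩ h
    congr 1
    refine LinearMap.ext fun x => ?_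
    obtain ⟨x, rfl⟩ := Submodule.mkQ_surjective _ x
    have : g ∘ₗ C.extRelations.mkQ = F := TensorProduct.ext' fun m n => (h m n).trans (hFt m n).symm
    exact LinearMap.congr_fun this x

/-- The iterated exterior product `C ∧ʲ P = (⋯((C ∧ P) ∧ P) ⋯ ∧ P)` with `j` factors `P`. -/
def extPow (C : CrossedModule.{u, v, v} K P) : ℕ → CrossedModule.{u, v, v} K P
  | 0 => C
  | j + 1 => (extPow C j).extProd

/-- The element `(⋯((m ∧ p₁) ∧ p₂) ⋯ ∧ pⱼ)` of `C ∧ʲ P`. -/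
def iterWedge (C : CrossedModule.{u, v, v} K P) (m : C.carrier) :
    (j : ℕ) → (Fin j → P) → (extPow C j).carrier
  | 0, _ => m
  | j + 1, p => (extPow C j).wedge (iterWedge C m j (Fin.init p)) (p (Fin.last j))

end CrossedModule

/-- The iterated bracket `[⋯[[x, y₁], y₂], ⋯, yⱼ]`. -/
def iterBr (K : Type u) {L : Type v} [CommRing K] [AddCommGroup L] [Module K L]
    [LieSuperalgebra K L] (x : L) : (j : ℕ) → (Fin j → L) → L
  | 0, _ => x
  | j + 1, y => br (K := K) (iterBr K x j (Fin.init y)) (y (Fin.last j))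

namespace GradedIdeal

variable {K : Type u} [CommRing K] {L : Type v} [AddCommGroup L] [Module K L] [LieSuperalgebra K L]

/-- The action of `L` on its ideal `M` by the bracket. -/
def adAct (M : GradedIdeal K L) : L →ₗ[K] M.toSubmodule →ₗ[K] M.toSubmodule :=
  LinearMap.mk₂ K (fun l m => ⟨br (K := K) l (m : L), M.br_left l m.2⟩)
    (by intros; ext; simp) (by intros; ext; simp) (by intros; ext; simp) (by intros; ext; simp)

theorem jacobi_right {i j : ZMod 2} {a b : L} (ha : a ∈ grade (K := K) (A := L) i)
    (hb : b ∈ grade (K := K) (A := L) j) (c : L) :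
    br (K := K) a (br (K := K) b c) = br (K := K) (br (K := K) a b) c
      + ksign i j • br (K := K) b (br (K := K) a c) := CrossedModule.jacobi' ha hb c

/-- If `N` is a graded ideal with `[N, M] = 0`, the crossed module `M → L / N` induced by the
inclusion, where `L / N` acts on `M` by the bracket of `L`. -/
def crossedQuot (M N : GradedIdeal K L)
    (h : ∀ k ∈ N.toSubmodule, ∀ m ∈ M.toSubmodule, br (K := K) k m = 0) :
    CrossedModule.{u, v, v} K (L ⧸ N.toSubmodule) where
  carrier := M.toSubmodule
  bd :=
    { toLinearMap := N.toSubmodule.mkQ ∘ₗ M.toSubmodule.subtype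
      map_grade := fun hx => ⟨_, hx, rfl⟩
      map_br := fun _ _ => rfl }
  act := N.toSubmodule.liftQ M.adAct (by
    intro k hk
    refine LinearMap.ext fun m => Subtype.ext ?_
    exact h k hk m m.2)
  act_mem := by
    rintro i j _ m ⟨p, hp, rfl⟩ hm
    exact br_mem (K := K) (A := L) hp hm
  act_br := by
    rintro i j _ _ m ⟨p, hp, rfl⟩ ⟨q, hq, rfl⟩
    refine Subtype.ext ?_
    exact eq_sub_of_add_eq (jacobi_right hp hq (m : L)).symm
  act_deriv := by
    rintro i j _ m m' ⟨p, hp, rfl⟩ hm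
    exact Subtype.ext (jacobi_right hp hm (m' : L))
  bd_act := by
    intro p m
    obtain ⟨p, rfl⟩ := Submodule.mkQ_surjective _ p
    rfl
  peiffer _ _ := rfl

/-- A graded ideal `M` of `L`, as a crossed `L`-module: the inclusion `M → L` with the action of
`L` on `M` by the bracket. -/
def crossed (M : GradedIdeal K L) : CrossedModule.{u, v, v} K L where
  carrier := M.toSubmodule
  bd := M.incl
  act := M.adAct
  act_mem hp hm := br_mem (K := K) (A := L) hp hm
  act_br m hp hq := Subtype.ext (eq_sub_of_add_eq (jacobi_right hp hq (m : L)).symm)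
  act_deriv m' hp hm := Subtype.ext (jacobi_right hp hm (m' : L))
  bd_act _ _ := rfl
  peiffer _ _ := rfl

/-- The Lie superalgebra `M ∧ᶜ L`. -/
abbrev ExtPower (M : GradedIdeal K L) (c : ℕ) : Type v := (M.crossed.extPow c).carrier

/-- The homomorphism `θ_c : M ∧ᶜ L → L`, `m ∧ l₁ ∧ ⋯ ∧ l_c ↦ [⋯[m, l₁], ⋯, l_c]`. -/
def theta (M : GradedIdeal K L) (c : ℕ) : SuperHom K (M.ExtPower c) L := (M.crossed.extPow c).bd

theorem theta_iterWedge (M : GradedIdeal K L) (m : M.toSubmodule) (c : ℕ) (l : Fin c → L) :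
    M.theta c (M.crossed.iterWedge m c l) = iterBr K (m : L) c l := by
  induction c with
  | zero => rfl
  | succ c ih =>
    have h := (M.crossed.extPow c).bd_wedge (M.crossed.iterWedge m c (Fin.init l)) (l (Fin.last c))
    have h' := ih (Fin.init l)
    change (M.crossed.extPow c).bd _ = _ at h'
    rw [h'] at h
    exact h

/-- For an `n`-central graded ideal `M`, the Lie superalgebra `M ∧ᶜ (L / γ_{n+1}(L))`. -/
abbrev ExtPowerQuot (M : GradedIdeal K L) {n : ℕ} (h : M.IsCentral n) (c : ℕ) : Type v :=
  ((M.crossedQuot _ h.br_lcs_eq_zero).extPow c).carrier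

end GradedIdeal

/-- The `c`-nilpotent multiplier `(R ∩ γ_{c+1}(F)) / γ_{c+1}(R, F)` attached to a homomorphism
`π : F → L` with kernel `R`.  When `F` is free and `π` is surjective, i.e. when
`0 → R → F → L → 0` is a free presentation, this is `M^(c)(L)`. -/
abbrev Multiplier {K : Type u} [CommRing K] {F : Type w} [AddCommGroup F] [Module K F]
    [LieSuperalgebra K F] {L : Type v} [AddCommGroup L] [Module K L] [LieSuperalgebra K L]
    (π : SuperHom K F L) (c : ℕ) : Type w :=
  GradedIdeal.Subquotient (GradedIdeal.ker π ⊓ (⊤ : GradedIdeal K F).lcs c)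
    ((GradedIdeal.ker π).lcs c)

end

open SuperAlgebra

noncomputable section

/-! ### Gradings, factorizations and maps on subquotients -/

namespace SuperAlgebra

variable {K : Type u} [CommRing K] {A : Type v} [AddCommGroup A] [Module K A] [SuperAlgebra K A]

/-! Put R = ker π, S = ker ρ and T = π⁻¹(M). Both (F, T) and (F', S) are free presentations of L /
M, so M^(c)(L / M) might as well be (T ∩ γ_{c+1}(F)) / γ_{c+1}(T, F), with φ induced by the identity
of F. In this model the kernel of φ is (R ∩ γ_{c+1}(T, F)) / γ_{c+1}(R, F), and π identifies the
cokernel of φ with (M ∩ γ_{c+1}(L)) / γ_{c+1}(M, L).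

The comparison of presentations is carried out with two lifts instead of an isomorphism.
Projectivity of free Lie superalgebras (`FreeLieSuper.exists_lift`) gives f : F → F' and h : F' → F
over L / M. Then f maps T into S, h maps S into T, and h ∘ f and f ∘ h are the identity modulo T and
S. The decisive fact is `sub_mem_lcs`: homomorphisms that agree modulo an ideal I agree on γ_{c+1}
modulo γ_{c+1}(I, -). It rests on the inclusion [γ_j(I, L), γ_k(L)] ⊆ γ_{j+k}(I, L), and it yields
the independence of φ, δ and ε of all choices as well as exactness at M^(c)(L / M).

It remains to realize the kernel of φ as an image. The isomorphism M ≅ T / R extends, one exterior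
factor at a time, to a homomorphism Ψ : M ∧ᶜ L → F / γ_{c+1}(R, F), because taking brackets of lifts
is an exterior pairing (`IsCompatible.exists_extProd_hom`). Its image is γ_{c+1}(T, F) / γ_{c+1}(R,
F), and Ψ followed by the map to L is θ_c. Hence Ψ maps ker θ_c onto the kernel of φ.

If M is n-central, then γ_{n+1}(T, F) ⊆ R, and therefore [γ_{j+1}(T, F), γ_{n+1}(F)] ⊆ γ_{j+n+2}(T,
F) ⊆ γ_{j+2}(R, F). The pairings thus descend to L / γ_{n+1}(L). For n ≤ c moreover γ_{c+1}(M, L) =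
0, so the whole image lies in the multiplier and the last quotient is M ∩ γ_{c+1}(L) itself. -/

theorem eq_of_add_eq_add {a a' b b' : A} (ha : a ∈ grade (K := K) (A := A) 0)
    (ha' : a' ∈ grade (K := K) (A := A) 0) (hb : b ∈ grade (K := K) (A := A) 1)
    (hb' : b' ∈ grade (K := K) (A := A) 1) (h : a + b = a' + b') : a = a' ∧ b = b' := by
  have e : a - a' = b' - b := by rw [sub_eq_sub_iff_add_eq_add, h, add_comm]
  have hz : a - a' = 0 := by
    refine (Submodule.disjoint_def.1 (isCompl (K := K) (A := A)).disjoint) _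
      (Submodule.sub_mem _ ha ha') ?_
    rw [e]
    exact Submodule.sub_mem _ hb' hb
  refine ⟨sub_eq_zero.1 hz, ?_⟩
  rw [hz] at e
  exact (sub_eq_zero.1 e.symm).symm

end SuperAlgebra

namespace SuperHom

variable {K : Type u} [CommRing K] {A : Type v} [AddCommGroup A] [Module K A] [SuperAlgebra K A]
variable {B : Type w} [AddCommGroup B] [Module K B] [SuperAlgebra K B]
variable {D : Type w₁} [AddCommGroup D] [Module K D] [SuperAlgebra K D]

/-- The composition of homomorphisms of superalgebras. -/
def comp (g : SuperHom K B D) (f : SuperHom K A B) : SuperHom K A D where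
  toLinearMap := g.toLinearMap ∘ₗ f.toLinearMap
  map_grade h := g.map_grade (f.map_grade h)
  map_br a b := by simp only [LinearMap.comp_apply, f.map_br, g.map_br]

@[simp] theorem comp_apply (g : SuperHom K B D) (f : SuperHom K A B) (a : A) :
    g.comp f a = g (f a) := rfl

/-- The identity of a superalgebra. -/
def id (K : Type u) [CommRing K] (A : Type v) [AddCommGroup A] [Module K A] [SuperAlgebra K A] :
    SuperHom K A A where
  toLinearMap := LinearMap.id
  map_grade h := h
  map_br _ _ := rfl

@[simp] theorem id_apply (a : A) : SuperHom.id K A a = a := rfl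

/-- An even map sends the components of any preimage of b to the components of b, so the component
of degree i of a preimage is again a preimage. -/
theorem exists_homog_preimage (f : SuperHom K A B) (hf : Function.Surjective f) {i : ZMod 2}
    {b : B} (hb : b ∈ grade (K := K) (A := B) i) :
    ∃ a ∈ grade (K := K) (A := A) i, f a = b := by
  obtain ⟨x, rfl⟩ := hf b
  obtain ⟨a, ha, a', ha', rfl⟩ := SuperAlgebra.exists_decomp K x
  rw [map_add] at hb
  rcases zmod_two_cases i with rfl | rfl
  · refine ⟨a, ha, ?_⟩
    have := (eq_of_add_eq_add (f.map_grade ha) hb (f.map_grade ha') (Submodule.zero_mem _)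
      (add_zero _).symm).1
    rw [map_add]; exact this
  · refine ⟨a', ha', ?_⟩
    have := (eq_of_add_eq_add (f.map_grade ha) (Submodule.zero_mem _) (f.map_grade ha') hb
      (zero_add _).symm).2
    rw [map_add]; exact this

/-- The component of x in the other degree is sent to 0. This supplies the evenness of maps defined
by choosing preimages under an injective homomorphism. -/
theorem mem_grade_of_injective (f : SuperHom K A B) (hf : Function.Injective f) {i : ZMod 2}
    {x : A} (hx : f x ∈ grade (K := K) (A := B) i) : x ∈ grade (K := K) (A := A) i := by
  obtain ⟨a, ha, a', ha', rfl⟩ := SuperAlgebra.exists_decomp K x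
  rw [map_add] at hx
  rcases zmod_two_cases i with rfl | rfl
  · have := (eq_of_add_eq_add (f.map_grade ha) hx (f.map_grade ha') (Submodule.zero_mem _)
      (add_zero _).symm).2
    rw [(map_eq_zero_iff f.toLinearMap hf).1 this, add_zero]
    exact ha
  · have := (eq_of_add_eq_add (f.map_grade ha) (Submodule.zero_mem _) (f.map_grade ha') hx
      (zero_add _).symm).1
    rw [(map_eq_zero_iff f.toLinearMap hf).1 this, zero_add]
    exact ha'

/-- A homomorphism whose values lie in the image of an injective one factors through it. -/
theorem exists_factor_of_injective (f : SuperHom K A B) (i : SuperHom K D B)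
    (hi : Function.Injective i) (h : ∀ a, ∃ d, i d = f a) :
    ∃ g : SuperHom K A D, ∀ a, i (g a) = f a := by
  -- Preimages under i are unique, so each property of the chosen function can be tested after
  -- applying i.
  choose g hg using h
  refine ⟨⟨⟨⟨g, fun a b => hi ?_⟩, fun r a => hi ?_⟩, fun {k a} ha => ?_, fun a b => hi ?_⟩, hg⟩
  · rw [hg, map_add, map_add, hg, hg]
  · rw [hg, map_smul, RingHom.id_apply, map_smul, hg]
  · refine i.mem_grade_of_injective hi ?_
    change i (g a) ∈ _
    rw [hg]
    exact f.map_grade ha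
  · change i (g (br (K := K) a b)) = i (br (K := K) (g a) (g b))
    rw [hg, f.map_br, i.map_br, hg, hg]

/-- A homomorphism which vanishes on a graded ideal factors through the quotient. -/
theorem exists_quotient_lift (f : SuperHom K A B) (I : GradedIdeal K A)
    (h : ∀ x ∈ I.toSubmodule, f x = 0) :
    ∃ g : SuperHom K (A ⧸ I.toSubmodule) B, ∀ a, g (I.toSubmodule.mkQ a) = f a := by
  refine ⟨⟨I.toSubmodule.liftQ f.toLinearMap h, ?_, ?_⟩, fun a => rfl⟩
  · rintro i _ ⟨a, ha, rfl⟩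
    exact f.map_grade ha
  · intro a b
    obtain ⟨a, rfl⟩ := Submodule.mkQ_surjective _ a
    obtain ⟨b, rfl⟩ := Submodule.mkQ_surjective _ b
    exact f.map_br a b

/-- The map induced on a subquotient `J / (J ∩ I)` by a homomorphism which vanishes on `J ∩ I` and
takes values in the image of an injective homomorphism on `J`. -/
theorem exists_subquotient_map (f : SuperHom K A B) (i : SuperHom K D B)
    (hi : Function.Injective i) (J I : GradedIdeal K A)
    (hJ : ∀ x ∈ J.toSubmodule, ∃ d, i d = f x)
    (hI : ∀ x ∈ I.toSubmodule, f x = 0) :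
    ∃ g : SuperHom K (GradedIdeal.Subquotient J I) D,
      ∀ x : J.toSubmodule, i (g (Submodule.Quotient.mk x)) = f x := by
  obtain ⟨k, hk⟩ := exists_quotient_lift (f.comp J.incl) (J.restrict I) fun x hx => hI _ hx
  obtain ⟨g, hg⟩ := exists_factor_of_injective k i hi fun a => by
    obtain ⟨a, rfl⟩ := Submodule.mkQ_surjective _ a
    obtain ⟨d, hd⟩ := hJ a a.2
    exact ⟨d, hd.trans (hk a).symm⟩
  exact ⟨g, fun x => (hg _).trans (hk x)⟩

end SuperHom

/-! ### The relative lower central series -/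

namespace GradedIdeal

variable {K : Type u} [CommRing K] {L : Type v} [AddCommGroup L] [Module K L] [LieSuperalgebra K L]
variable {G : Type w} [AddCommGroup G] [Module K G] [LieSuperalgebra K G]

theorem bracketTop_mono {I J : GradedIdeal K L} (h : I.toSubmodule ≤ J.toSubmodule) :
    I.bracketTop.toSubmodule ≤ J.bracketTop.toSubmodule := by
  refine Submodule.span_mono ?_
  rintro _ ⟨x, hx, y, rfl⟩
  exact ⟨x, h hx, y, rfl⟩

theorem br_mem_bracketTop {I : GradedIdeal K L} {x : L} (hx : x ∈ I.toSubmodule) (y : L) :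
    br (K := K) x y ∈ I.bracketTop.toSubmodule := Submodule.subset_span ⟨x, hx, y, rfl⟩

theorem lcs_mono {I J : GradedIdeal K L} (h : I.toSubmodule ≤ J.toSubmodule) (k : ℕ) :
    (I.lcs k).toSubmodule ≤ (J.lcs k).toSubmodule := by
  induction k with
  | zero => exact h
  | succ k ih => exact bracketTop_mono ih

theorem bracketTop_le (I : GradedIdeal K L) : I.bracketTop.toSubmodule ≤ I.toSubmodule := by
  refine Submodule.span_le.2 ?_
  rintro _ ⟨x, hx, y, rfl⟩
  exact I.br_right y hx

theorem lcs_antitone (I : GradedIdeal K L) {j k : ℕ} (h : j ≤ k) :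
    (I.lcs k).toSubmodule ≤ (I.lcs j).toSubmodule := by
  induction h with
  | refl => exact le_rfl
  | step _ ih => exact (bracketTop_le _).trans ih

/-- Restarting the series at a later term makes it possible to enlarge that term: in the n-central
case γ_{n+1}(T, F) is replaced by R inside a longer bracket. -/
theorem lcs_add (I : GradedIdeal K L) (j k : ℕ) : I.lcs (j + k) = (I.lcs j).lcs k := by
  induction k with
  | zero => rfl
  | succ k ih => exact congrArg bracketTop ih

/-- Skew symmetry is available for homogeneous elements only; since I and J are graded, the
components of x and y stay inside them. -/
theorem br_mem_comm {I J N : GradedIdeal K L}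
    (h : ∀ x ∈ I.toSubmodule, ∀ y ∈ J.toSubmodule, br (K := K) x y ∈ N.toSubmodule) :
    ∀ x ∈ I.toSubmodule, ∀ y ∈ J.toSubmodule, br (K := K) y x ∈ N.toSubmodule := by
  intro x hx y hy
  obtain ⟨a, ha, ha0, b, hb, hb1, rfl⟩ := I.exists_decomp hx
  obtain ⟨c, hc, hc0, d, hd, hd1, rfl⟩ := J.exists_decomp hy
  simp only [map_add, LinearMap.add_apply]
  have key : ∀ {i j : ZMod 2} {x y : L}, x ∈ I.toSubmodule → y ∈ J.toSubmodule →
      x ∈ grade (K := K) (A := L) i → y ∈ grade (K := K) (A := L) j →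
      br (K := K) y x ∈ N.toSubmodule := by
    intro i j x y hx hy hi hj
    rw [LieSuperalgebra.skew hj hi]
    exact neg_mem (zsmul_mem (h x hx y hy) _)
  exact add_mem (add_mem (key ha hc ha0 hc0) (key ha hd ha0 hd1))
    (add_mem (key hb hc hb1 hc0) (key hb hd hb1 hd1))

/-- `[γ_j(I, L), γ_k(L)] ⊆ γ_{j+k}(I, L)`. -/
theorem br_lcs_lcs_mem (I : GradedIdeal K L) (k : ℕ) : ∀ (j : ℕ), ∀ x ∈ (I.lcs j).toSubmodule,
    ∀ y ∈ ((⊤ : GradedIdeal K L).lcs k).toSubmodule,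
    br (K := K) x y ∈ (I.lcs (j + k + 1)).toSubmodule := by
  induction k with
  | zero => exact fun j x hx y _ => br_mem_bracketTop hx y
  | succ k ih =>
    intro j x hx y hy
    suffices h : ((⊤ : GradedIdeal K L).lcs (k + 1)).toSubmodule ≤
        (I.lcs (j + (k + 1) + 1)).toSubmodule.comap (br (K := K) x) from h hy
    refine Submodule.span_le.2 ?_
    rintro _ ⟨a, ha, y, rfl⟩
    change br (K := K) x (br (K := K) a y) ∈ (I.lcs (j + (k + 1) + 1)).toSubmodule
    have key : ∀ {i l : ZMod 2} {x a : L}, x ∈ (I.lcs j).toSubmodule →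
        x ∈ grade (K := K) (A := L) i → a ∈ ((⊤ : GradedIdeal K L).lcs k).toSubmodule →
        a ∈ grade (K := K) (A := L) l →
        br (K := K) x (br (K := K) a y) ∈ (I.lcs (j + (k + 1) + 1)).toSubmodule := by
      intro i l x a hx hi ha hl
      -- The Jacobi identity gives [[x, a], y] ± [a, [x, y]]. The first term uses the induction
      -- hypothesis at j. In the second, [x, y] is one step deeper in the series of I, so the
      -- hypothesis is needed at j + 1; this is why j stays universally quantified in the induction
      -- on k.
      rw [jacobi_right hi hl]
      refine add_mem (br_mem_bracketTop (ih j x hx a ha) y) (zsmul_mem ?_ _)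
      have := br_mem_comm (ih (j + 1)) _ (br_mem_bracketTop hx y) a ha
      rwa [show j + 1 + k + 1 = j + (k + 1) + 1 by ring] at this
    obtain ⟨u, hu, hu0, u', hu', hu1, rfl⟩ := GradedIdeal.exists_decomp _ hx
    obtain ⟨b, hb, hb0, b', hb', hb1, rfl⟩ := GradedIdeal.exists_decomp _ ha
    simp only [map_add, LinearMap.add_apply]
    exact add_mem (add_mem (key hu hu0 hb hb0) (key hu' hu1 hb hb0))
      (add_mem (key hu hu0 hb' hb1) (key hu' hu1 hb' hb1))

/-- A homomorphism maps `γ_k(I, G)` into `γ_k(J, L)` if it maps `I` into `J`. -/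
theorem map_lcs_mem (f : SuperHom K G L) {I : GradedIdeal K G} {J : GradedIdeal K L}
    (h : ∀ x ∈ I.toSubmodule, f x ∈ J.toSubmodule) (k : ℕ) :
    ∀ x ∈ (I.lcs k).toSubmodule, f x ∈ (J.lcs k).toSubmodule := by
  induction k with
  | zero => exact h
  | succ k ih =>
    suffices h : (I.lcs (k + 1)).toSubmodule ≤ (J.lcs (k + 1)).toSubmodule.comap f.toLinearMap from
      fun x hx => h hx
    refine Submodule.span_le.2 ?_
    rintro _ ⟨a, ha, y, rfl⟩
    change f (br (K := K) a y) ∈ (J.lcs (k + 1)).toSubmodule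
    rw [f.map_br]
    exact br_mem_bracketTop (ih a ha) _

/-- A surjective homomorphism which maps `I` onto `J` maps `γ_k(I, G)` onto `γ_k(J, L)`. -/
theorem exists_lcs_preimage (f : SuperHom K G L) (hf : Function.Surjective f)
    {I : GradedIdeal K G} {J : GradedIdeal K L}
    (h : ∀ y ∈ J.toSubmodule, ∃ x ∈ I.toSubmodule, f x = y) (k : ℕ) :
    ∀ y ∈ (J.lcs k).toSubmodule, ∃ x ∈ (I.lcs k).toSubmodule, f x = y := by
  induction k with
  | zero => exact h
  | succ k ih =>
    suffices h : (J.lcs (k + 1)).toSubmodule ≤ (I.lcs (k + 1)).toSubmodule.map f.toLinearMap from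
      fun x hx => h hx
    refine Submodule.span_le.2 ?_
    rintro _ ⟨a, ha, y, rfl⟩
    obtain ⟨b, hb, rfl⟩ := ih a ha
    obtain ⟨y, rfl⟩ := hf y
    exact ⟨br (K := K) b y, br_mem_bracketTop hb y, f.map_br b y⟩

/-- Two homomorphisms which agree modulo `I` agree on `γ_k(G)` modulo `γ_k(I, L)`. -/
theorem sub_mem_lcs (f g : SuperHom K G L) {I : GradedIdeal K L}
    (h : ∀ x, f x - g x ∈ I.toSubmodule) (k : ℕ) :
    ∀ x ∈ ((⊤ : GradedIdeal K G).lcs k).toSubmodule, f x - g x ∈ (I.lcs k).toSubmodule := by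
  induction k with
  | zero => exact fun x _ => h x
  | succ k ih =>
    suffices h : ((⊤ : GradedIdeal K G).lcs (k + 1)).toSubmodule ≤
        (I.lcs (k + 1)).toSubmodule.comap (f.toLinearMap - g.toLinearMap) from fun x hx => h hx
    refine Submodule.span_le.2 ?_
    rintro _ ⟨a, ha, y, rfl⟩
    change f (br (K := K) a y) - g (br (K := K) a y) ∈ (I.lcs (k + 1)).toSubmodule
    -- The first summand lies in [γ_{k+1}(I, L), L] by induction. In the second, only f y - g y lies
    -- in I, while g a lies in γ_{k+1}(L); here the inclusion [I, γ_{k+1}(L)] ⊆ γ_{k+2}(I, L) is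
    -- used.
    have e : f (br (K := K) a y) - g (br (K := K) a y) =
        br (K := K) (f a - g a) (f y) + br (K := K) (g a) (f y - g y) := by
      rw [f.map_br, g.map_br]
      simp only [map_sub, LinearMap.sub_apply]
      abel
    rw [e]
    refine add_mem (br_mem_bracketTop (ih a ha) _) ?_
    have hg := map_lcs_mem g (I := ⊤) (J := ⊤) (fun _ _ => trivial) k a ha
    have := br_mem_comm (br_lcs_lcs_mem I k 0) _ (h y) _ hg
    rwa [Nat.zero_add] at this

/-- Each further bracket with L descends one step in the upper central series. The bound k ≤ n keeps
the subtraction in ℕ honest. -/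
theorem lcs_le_upperCentral {M : GradedIdeal K L} {n : ℕ} (h : M.IsCentral n) :
    ∀ k, k ≤ n → (M.lcs k).toSubmodule ≤ upperCentral K L (n - k) := by
  intro k
  induction k with
  | zero => exact fun _ => h
  | succ k ih =>
    intro hk
    refine Submodule.span_le.2 ?_
    rintro _ ⟨a, ha, y, rfl⟩
    have := ih (by omega) ha
    rw [show n - k = (n - (k + 1)) + 1 by omega] at this
    exact mem_upperCentral_succ.1 this y

/-- If `M` is `n`-central then `γ_{c+1}(M, L) = 0` for `c ≥ n`. -/
theorem IsCentral.lcs_eq_zero {M : GradedIdeal K L} {n : ℕ} (h : M.IsCentral n) {c : ℕ}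
    (hc : n ≤ c) : ∀ x ∈ (M.lcs c).toSubmodule, x = 0 := by
  intro x hx
  have := lcs_le_upperCentral h n le_rfl (lcs_antitone M hc hx)
  rwa [Nat.sub_self] at this

end GradedIdeal

/-! ### Projectivity of free Lie superalgebras -/

/-- Free Lie superalgebras are projective. -/
theorem FreeLieSuper.exists_lift {K : Type u} [CommRing K] {X : Type w} (d : X → ZMod 2)
    {A : Type v} [AddCommGroup A] [Module K A] [LieSuperalgebra K A]
    {B : Type w₁} [AddCommGroup B] [Module K B] [LieSuperalgebra K B]
    (σ : SuperHom K A B) (hσ : Function.Surjective σ) (τ : SuperHom K (FreeLieSuper K d) B) :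
    ∃ f : SuperHom K (FreeLieSuper K d) A, ∀ x, σ (f x) = τ x := by
  have hof : ∀ x, FreeLieSuper.of K d x ∈ grade (K := K) (A := FreeLieSuper K d) (d x) := by
    intro x
    refine ⟨FreeNonUnitalNonAssocAlgebra.of K x, ?_, rfl⟩
    change MonoidAlgebra.single (FreeMagma.of x) (1 : K) ∈
      MonoidAlgebra.supported K K {s : FreeMagma X | monomialDegree d s = d x}
    rw [MonoidAlgebra.supported_eq_span_single]
    exact Submodule.subset_span ⟨FreeMagma.of x, rfl, rfl⟩
  -- The universal property applies to degree-preserving maps only, so the generators need preimages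
  -- of the right degree.
  choose a ha haσ using fun x => σ.exists_homog_preimage hσ (τ.map_grade (hof x))
  obtain ⟨f, hf, -⟩ := FreeLieSuper.existsUnique_lift K d a ha
  -- Only the uniqueness of t matters: σ ∘ f and τ take the same values on generators, hence both
  -- equal t.
  obtain ⟨t, -, ht⟩ := FreeLieSuper.existsUnique_lift K d (fun x => τ (FreeLieSuper.of K d x))
    fun x => τ.map_grade (hof x)
  have h1 : σ.comp f = t := ht _ fun x => by
    change σ (f (FreeLieSuper.of K d x)) = _
    rw [hf, haσ]
  have h2 : τ = t := ht _ fun x => rfl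
  refine ⟨f, fun x => ?_⟩
  rw [h2, ← h1]
  rfl

/-! ### Homomorphisms from exterior products given by brackets of lifts -/

namespace CrossedModule

variable {K : Type u} [CommRing K] {P : Type v} [AddCommGroup P] [Module K P] [LieSuperalgebra K P]
variable {G : Type w₁} [AddCommGroup G] [Module K G] [LieSuperalgebra K G]

/-- A homomorphism `Ψ : C → G / I` with image `N / I` is compatible with the homomorphism
`q : G → P` if it is equivariant and commutes with the maps to `P`. -/
structure IsCompatible (C : CrossedModule.{u, v, w} K P) (q : SuperHom K G P)
    (N I : GradedIdeal K G) (Ψ : SuperHom K C.carrier (G ⧸ I.toSubmodule)) : Prop where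
  exists_mem : ∀ m, ∃ x ∈ N.toSubmodule, Ψ m = I.toSubmodule.mkQ x
  surj : ∀ x ∈ N.toSubmodule, ∃ m, Ψ m = I.toSubmodule.mkQ x
  act : ∀ y m x, Ψ m = I.toSubmodule.mkQ x → Ψ (C.act (q y) m) = I.toSubmodule.mkQ (br (K := K) y x)
  bd : ∀ m x, Ψ m = I.toSubmodule.mkQ x → C.bd m = q x

variable {C : CrossedModule.{u, v, w} K P} {q : SuperHom K G P} {N I : GradedIdeal K G}
  {Ψ : SuperHom K C.carrier (G ⧸ I.toSubmodule)}

/-- Compatibility provides one representative of Ψ m in N; as I ⊆ N, every representative then lies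
in N. -/
theorem IsCompatible.mem (h : IsCompatible C q N I Ψ) (hIN : I.toSubmodule ≤ N.toSubmodule)
    {m : C.carrier} {x : G} (hx : Ψ m = I.toSubmodule.mkQ x) : x ∈ N.toSubmodule := by
  obtain ⟨x', hx', e⟩ := h.exists_mem m
  have : x - x' ∈ I.toSubmodule := (Submodule.Quotient.eq _).1 (hx.symm.trans e)
  have := add_mem (hIN this) hx'
  rwa [sub_add_cancel] at this

theorem extProd_act_wedge {k i : ZMod 2} {p : P} {m : C.carrier} (n : P)
    (hp : p ∈ grade (K := K) (A := P) k) (hm : m ∈ grade (K := K) (A := C.carrier) i) :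
    C.extProd.act p (C.wedge m n) =
      C.wedge (C.act p m) n + ksign k i • C.wedge m (br (K := K) p n) := by
  change C.extRelations.mkQ (C.tensorAct p (m ⊗ₜ[K] n)) = _
  rw [tensorAct_tmul n hp hm, map_add, map_zsmul]
  rfl

/-- Submodules of `C ∧ P` which contain the elements `m ∧ n` for homogeneous `m` and `n`. -/
theorem wedge_induction {q : Submodule K C.extProd.carrier}
    (h : ∀ (i j : ZMod 2) (m : C.carrier) (n : P), m ∈ grade (K := K) (A := C.carrier) i →
      n ∈ grade (K := K) (A := P) j → C.wedge m n ∈ q) (t : C.extProd.carrier) : t ∈ q := by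
  obtain ⟨t, rfl⟩ := Submodule.mkQ_surjective _ t
  exact tensor_induction (q := q.comap (C.extRelations.mkQ)) h t

/-- The class of [x, y] modulo I' does not depend on the lifts: changing x alters it by an element
of [I, G], changing y by an element of [N, ker q]. Bilinearity follows, because sums and multiples
of lifts are lifts of sums and multiples. -/
theorem IsCompatible.exists_pairing (h : IsCompatible C q N I Ψ) (hq : Function.Surjective q)
    (hIN : I.toSubmodule ≤ N.toSubmodule) {I' : GradedIdeal K G}
    (hI : ∀ x ∈ I.toSubmodule, ∀ y, br (K := K) x y ∈ I'.toSubmodule)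
    (hN : ∀ x ∈ N.toSubmodule, ∀ y, q y = 0 → br (K := K) x y ∈ I'.toSubmodule) :
    ∃ b : C.carrier →ₗ[K] P →ₗ[K] (G ⧸ I'.toSubmodule),
      ∀ m x y, Ψ m = I.toSubmodule.mkQ x → b m (q y) = I'.toSubmodule.mkQ (br (K := K) x y) := by
  choose s _ hsΨ using h.exists_mem
  choose t ht using hq
  have key : ∀ m x y, Ψ m = I.toSubmodule.mkQ x →
      I'.toSubmodule.mkQ (br (K := K) (s m) (t (q y))) = I'.toSubmodule.mkQ (br (K := K) x y) := by
    intro m x y hx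
    refine (Submodule.Quotient.eq _).2 ?_
    have e : br (K := K) (s m) (t (q y)) - br (K := K) x y =
        br (K := K) (s m - x) (t (q y)) + br (K := K) x (t (q y) - y) := by
      simp only [map_sub, LinearMap.sub_apply]; abel
    rw [e]
    refine add_mem (hI _ ?_ _) (hN _ (h.mem hIN hx) _ ?_)
    · exact (Submodule.Quotient.eq _).1 ((hsΨ m).symm.trans hx)
    · rw [map_sub, ht, sub_self]
  -- The chosen lifts s and t need not be additive. In this form, any convenient lift such as s m +
  -- s m' may replace the chosen lift of m + m'.
  have key' : ∀ m x n y, Ψ m = I.toSubmodule.mkQ x → q y = n →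
      I'.toSubmodule.mkQ (br (K := K) (s m) (t n)) = I'.toSubmodule.mkQ (br (K := K) x y) := by
    rintro m x n y hx rfl
    exact key m x y hx
  refine ⟨LinearMap.mk₂ K (fun m n => I'.toSubmodule.mkQ (br (K := K) (s m) (t n)))
    (fun m m' n => ?_) (fun r m n => ?_) (fun m n n' => ?_) (fun r m n => ?_), key⟩
  · rw [key' (m + m') (s m + s m') n (t n) (by rw [map_add, map_add, hsΨ, hsΨ]) (ht n), map_add,
      LinearMap.add_apply, map_add]
  · rw [key' (r • m) (r • s m) n (t n) (by rw [map_smul, map_smul, hsΨ]) (ht n), map_smul,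
      LinearMap.smul_apply, map_smul]
  · rw [key' m (s m) (n + n') (t n + t n') (hsΨ m) (by rw [map_add, ht, ht]), map_add, map_add]
  · rw [key' m (s m) (r • n) (r • t n) (hsΨ m) (by rw [map_smul, ht]), map_smul, map_smul]

theorem IsCompatible.exists_homog_lift (_h : IsCompatible C q N I Ψ) {i : ZMod 2} {m : C.carrier}
    (hm : m ∈ grade (K := K) (A := C.carrier) i) :
    ∃ x ∈ grade (K := K) (A := G) i, Ψ m = I.toSubmodule.mkQ x := by
  obtain ⟨x, hx, e⟩ := Ψ.map_grade hm
  exact ⟨x, hx, e.symm⟩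

/-- On homogeneous lifts the axioms of an exterior pairing turn into identities of the Lie
superalgebra G: the first two are forms of the Jacobi identity, the next two are skew symmetry, and
the last is [x, x] = 0 for even x. -/
theorem IsCompatible.exists_extProd_hom (h : IsCompatible C q N I Ψ) (hq : Function.Surjective q)
    (hIN : I.toSubmodule ≤ N.toSubmodule) {I' : GradedIdeal K G}
    (hI : ∀ x ∈ I.toSubmodule, ∀ y, br (K := K) x y ∈ I'.toSubmodule)
    (hN : ∀ x ∈ N.toSubmodule, ∀ y, q y = 0 → br (K := K) x y ∈ I'.toSubmodule) :
    ∃ Ψ' : SuperHom K C.extProd.carrier (G ⧸ I'.toSubmodule),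
      ∀ m x y, Ψ m = I.toSubmodule.mkQ x →
        Ψ' (C.wedge m (q y)) = I'.toSubmodule.mkQ (br (K := K) x y) := by
  obtain ⟨b, hb⟩ := h.exists_pairing hq hIN hI hN
  suffices H : ∃ f : SuperHom K C.extProd.carrier (G ⧸ I'.toSubmodule),
      ∀ m n, f (C.wedge m n) = b m n by
    obtain ⟨f, hf⟩ := H
    exact ⟨f, fun m x y hx => (hf _ _).trans (hb m x y hx)⟩
  refine (C.extProd_universal b ?_ ?_ ?_ ?_ ?_ ?_).exists
  · intro i j m n hm hn
    obtain ⟨x, hx, ex⟩ := h.exists_homog_lift hm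
    obtain ⟨y, hy, rfl⟩ := q.exists_homog_preimage hq hn
    rw [hb m x y ex]
    exact ⟨_, br_mem hx hy, rfl⟩
  · intro i j m m' n hm hm'
    obtain ⟨x, hx, ex⟩ := h.exists_homog_lift hm
    obtain ⟨x', hx', ex'⟩ := h.exists_homog_lift hm'
    obtain ⟨y, rfl⟩ := hq n
    rw [h.bd m x ex, h.bd m' x' ex', ← q.map_br, ← q.map_br, hb _ _ _ ex, hb _ _ _ ex',
      hb _ (br (K := K) x x') y (by rw [Ψ.map_br, ex, ex', GradedIdeal.mk_br]), ← map_zsmul,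
      ← map_sub, GradedIdeal.jacobi_right hx hx', add_sub_cancel_right]
  · intro i j k m n n' hm hn hn'
    obtain ⟨x, hx, ex⟩ := h.exists_homog_lift hm
    obtain ⟨y, hy, rfl⟩ := q.exists_homog_preimage hq hn
    obtain ⟨y', hy', rfl⟩ := q.exists_homog_preimage hq hn'
    -- The Jacobi identity with the inner brackets turned around, because P acts on C from the left;
    -- the signs are checked in all eight combinations of degrees.
    have e : br (K := K) x (br (K := K) y y') = ksign k (i + j) • br (K := K) (br (K := K) y' x) y
        - ksign i j • br (K := K) (br (K := K) y x) y' := by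
      rw [GradedIdeal.jacobi_right hx hy, LieSuperalgebra.skew hy (br_mem hx hy'),
        LieSuperalgebra.skew hx hy, LieSuperalgebra.skew hx hy']
      rcases zmod_two_cases i with rfl | rfl <;> rcases zmod_two_cases j with rfl | rfl <;>
        rcases zmod_two_cases k with rfl | rfl <;> simp <;> abel
    rw [← q.map_br, hb _ _ _ ex, hb _ _ y (h.act y' m x ex), hb _ _ y' (h.act y m x ex),
      e, map_sub, map_zsmul, map_zsmul]
  · intro i j m n m' n' hm hn
    obtain ⟨x, hx, ex⟩ := h.exists_homog_lift hm
    obtain ⟨y, hy, rfl⟩ := q.exists_homog_preimage hq hn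
    obtain ⟨x', -, ex'⟩ := h.exists_mem m'
    obtain ⟨y', rfl⟩ := hq n'
    rw [h.bd m' x' ex', ← q.map_br, hb _ _ _ ex, hb _ _ _ ex', hb _ _ _ (h.act y m x ex),
      GradedIdeal.mk_br, LieSuperalgebra.skew hx hy, ← map_zsmul, ← map_neg]
    simp only [map_neg, map_zsmul, LinearMap.neg_apply, LinearMap.smul_apply]
  · intro i j m m' hm hm'
    obtain ⟨x, hx, ex⟩ := h.exists_homog_lift hm
    obtain ⟨x', hx', ex'⟩ := h.exists_homog_lift hm'
    rw [h.bd m x ex, h.bd m' x' ex', hb _ _ _ ex, hb _ _ _ ex', ← map_zsmul, ← map_add,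
      LieSuperalgebra.skew hx hx', neg_add_cancel, map_zero]
  · intro m hm
    obtain ⟨x, hx, ex⟩ := h.exists_homog_lift hm
    rw [h.bd m x ex, hb _ _ _ ex, LieSuperalgebra.br_self_even hx, map_zero]

/-- This is the inductive step for iterated exterior products. Values on wedges are brackets of N
with G, so the image becomes [N, G] modulo I'; equivariance is the Jacobi identity in G, and
compatibility with the maps to P holds because both routes send m ∧ n to [∂m, n]. -/
theorem IsCompatible.extProd (h : IsCompatible C q N I Ψ) (hq : Function.Surjective q)
    {I' : GradedIdeal K G} (hI' : ∀ x ∈ I'.toSubmodule, q x = 0)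
    {Ψ' : SuperHom K C.extProd.carrier (G ⧸ I'.toSubmodule)}
    (hΨ' : ∀ m x y, Ψ m = I.toSubmodule.mkQ x →
        Ψ' (C.wedge m (q y)) = I'.toSubmodule.mkQ (br (K := K) x y)) :
    IsCompatible C.extProd q N.bracketTop I' Ψ' := by
  constructor
  · intro t
    suffices t ∈ (N.bracketTop.toSubmodule.map I'.toSubmodule.mkQ).comap Ψ'.toLinearMap by
      obtain ⟨x, hx, e⟩ := this
      exact ⟨x, hx, e.symm⟩
    refine wedge_induction ?_ t
    intro i j m n _ _
    obtain ⟨x, hx, ex⟩ := h.exists_mem m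
    obtain ⟨y, rfl⟩ := hq n
    exact ⟨_, GradedIdeal.br_mem_bracketTop hx y, (hΨ' m x y ex).symm⟩
  · suffices H : N.bracketTop.toSubmodule ≤
        (LinearMap.range Ψ'.toLinearMap).comap I'.toSubmodule.mkQ from fun x hx => H hx
    refine Submodule.span_le.2 ?_
    rintro _ ⟨x, hx, y, rfl⟩
    obtain ⟨m, hm⟩ := h.surj x hx
    exact ⟨C.wedge m (q y), hΨ' m x y hm⟩
  · intro y t x hx
    -- Replacing the class of x by Ψ' t makes the claim linear in t, so that it can be verified on
    -- elements m ∧ n.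
    rw [← GradedIdeal.mk_br, ← hx]
    refine homog_induction K (p := fun y => Ψ' (C.extProd.act (q y) t) =
      br (K := K) (I'.toSubmodule.mkQ y) (Ψ' t)) ?_ ?_ y
    · intro y y' hy hy'
      simp only [map_add, LinearMap.add_apply, hy, hy']
    intro k y hy
    refine wedge_induction (q := LinearMap.eqLocus (Ψ'.toLinearMap ∘ₗ C.extProd.act (q y))
      (br (K := K) (I'.toSubmodule.mkQ y) ∘ₗ Ψ'.toLinearMap)) ?_ t
    intro i j m n hm hn
    obtain ⟨x, hx, ex⟩ := h.exists_homog_lift hm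
    obtain ⟨z, rfl⟩ := hq n
    rw [LinearMap.mem_eqLocus, LinearMap.comp_apply, LinearMap.comp_apply,
      extProd_act_wedge _ (q.map_grade hy) hm, map_add, map_zsmul, ← q.map_br,
      hΨ' _ _ _ (h.act y m x ex), hΨ' _ _ _ ex, hΨ' _ _ _ ex, GradedIdeal.mk_br,
      GradedIdeal.jacobi_right hy hx, map_add, map_zsmul]
  · intro t x hx
    -- As q vanishes on I', it factors through a map k on G / I', and the claim becomes the equality
    -- of the linear maps ∂ and k ∘ Ψ'.
    obtain ⟨k, hk⟩ := q.exists_quotient_lift I' hI'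
    have e : q x = k (Ψ' t) := by rw [hx, hk]
    rw [e]
    refine wedge_induction (q := LinearMap.eqLocus C.extProd.bd.toLinearMap
      (k.toLinearMap ∘ₗ Ψ'.toLinearMap)) ?_ t
    intro i j m n _ _
    obtain ⟨x, -, ex⟩ := h.exists_mem m
    obtain ⟨y, rfl⟩ := hq n
    rw [LinearMap.mem_eqLocus, LinearMap.comp_apply, bd_wedge, hΨ' _ _ _ ex, hk, q.map_br,
      h.bd m x ex]

/-- A compatible homomorphism `C → G / R` with image `T / R` gives compatible homomorphisms
`C ∧ʲ P → G / γ_{j+1}(R, G)` with image `γ_{j+1}(T, G) / γ_{j+1}(R, G)`. -/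
theorem IsCompatible.exists_extPow_hom {C : CrossedModule.{u, v, v} K P} {T R : GradedIdeal K G}
    {Ψ : SuperHom K C.carrier (G ⧸ R.toSubmodule)} (h : IsCompatible C q T R Ψ)
    (hq : Function.Surjective q) (hRT : R.toSubmodule ≤ T.toSubmodule)
    (hR : ∀ x ∈ R.toSubmodule, q x = 0)
    (hT : ∀ j, ∀ x ∈ (T.lcs j).toSubmodule, ∀ y, q y = 0 →
      br (K := K) x y ∈ (R.lcs (j + 1)).toSubmodule) (j : ℕ) :
    ∃ Ψ' : SuperHom K (C.extPow j).carrier (G ⧸ (R.lcs j).toSubmodule),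
      IsCompatible (C.extPow j) q (T.lcs j) (R.lcs j) Ψ' ∧
      ∀ m x (y : Fin j → G), Ψ m = R.toSubmodule.mkQ x →
        Ψ' (C.iterWedge m j fun i => q (y i)) = (R.lcs j).toSubmodule.mkQ (iterBr K x j y) := by
  induction j with
  | zero => exact ⟨Ψ, h, fun m x y hx => hx⟩
  | succ j ih =>
    obtain ⟨Φ, hΦ, hw⟩ := ih
    obtain ⟨Ψ', hΨ'⟩ := hΦ.exists_extProd_hom hq (GradedIdeal.lcs_mono hRT j)
      (I' := R.lcs (j + 1)) (fun x hx y => GradedIdeal.br_mem_bracketTop hx y) (hT j)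
    refine ⟨Ψ', hΦ.extProd hq (fun x hx => hR x (GradedIdeal.lcs_le R _ hx)) hΨ', ?_⟩
    intro m x y hx
    exact hΨ' _ _ _ (hw m x (Fin.init y) hx)

end CrossedModule

/-! ### Kernels and quotients, and the maps φ, δ and ε between multipliers -/

namespace GradedIdeal

theorem mem_ker {K : Type u} [CommRing K] {A : Type v} [AddCommGroup A] [Module K A]
    [SuperAlgebra K A] {B : Type w} [AddCommGroup B] [Module K B] [SuperAlgebra K B]
    {f : SuperHom K A B} {x : A} : x ∈ (ker f).toSubmodule ↔ f x = 0 := Iff.rfl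

theorem toQuotient_eq_zero {K : Type u} [CommRing K] {A : Type v} [AddCommGroup A] [Module K A]
    [SuperAlgebra K A] {I : GradedIdeal K A} {x : A} :
    I.toQuotient x = 0 ↔ x ∈ I.toSubmodule := Submodule.Quotient.mk_eq_zero _

theorem toQuotient_eq {K : Type u} [CommRing K] {A : Type v} [AddCommGroup A] [Module K A]
    [SuperAlgebra K A] {I : GradedIdeal K A} {x y : A} :
    I.toQuotient x = I.toQuotient y ↔ x - y ∈ I.toSubmodule := Submodule.Quotient.eq _

end GradedIdeal

open GradedIdeal

namespace Multiplier

variable {K : Type u} [CommRing K] {L : Type v} [AddCommGroup L] [Module K L] [LieSuperalgebra K L]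
variable {F : Type w₁} [AddCommGroup F] [Module K F] [LieSuperalgebra K F]
variable {F' : Type w₂} [AddCommGroup F'] [Module K F'] [LieSuperalgebra K F']
variable {M : GradedIdeal K L} {π : SuperHom K F L} {ρ : SuperHom K F' (L ⧸ M.toSubmodule)}
variable {c : ℕ}

theorem mem_ker_of_mem_comap {f : SuperHom K F F'} (hf : ∀ x, ρ (f x) = M.toQuotient (π x)) :
    ∀ x ∈ (comap π M).toSubmodule, f x ∈ (ker ρ).toSubmodule :=
  fun x hx => mem_ker.2 ((hf x).trans (toQuotient_eq_zero.2 hx))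

theorem mem_comap_of_mem_ker {h : SuperHom K F' F} (hh : ∀ y, M.toQuotient (π (h y)) = ρ y) :
    ∀ y ∈ (ker ρ).toSubmodule, h y ∈ (comap π M).toSubmodule :=
  fun y hy => (toQuotient_eq_zero (I := M)).1 ((hh y).trans (mem_ker.1 hy))

theorem mem_of_mem_ker {g : SuperHom K F' L} (hg : ∀ y, M.toQuotient (g y) = ρ y) :
    ∀ y ∈ (ker ρ).toSubmodule, g y ∈ M.toSubmodule :=
  fun y hy => toQuotient_eq_zero.1 ((hg y).trans (mem_ker.1 hy))

theorem ker_le_comap (π : SuperHom K F L) (M : GradedIdeal K L) :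
    (ker π).toSubmodule ≤ (comap π M).toSubmodule := by
  intro x hx
  change π x ∈ M.toSubmodule
  rw [mem_ker.1 hx]
  exact Submodule.zero_mem _

/-- The map of multipliers induced by all lifts of the projection `L → L / M`. -/
theorem exists_map {f : SuperHom K F F'} (hf : ∀ x, ρ (f x) = M.toQuotient (π x)) :
    ∃ φ : SuperHom K (Multiplier π c) (Multiplier ρ c),
      ∀ f : SuperHom K F F', (∀ x, ρ (f x) = M.toQuotient (π x)) →
        ∀ x : (ker π ⊓ (⊤ : GradedIdeal K F).lcs c).toSubmodule,
          subquotientIncl _ _ (φ (Submodule.Quotient.mk x)) = ((ker ρ).lcs c).toQuotient (f x) := by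
  have hR : ∀ x ∈ (ker π).toSubmodule, f x ∈ (ker ρ).toSubmodule :=
    fun x hx => mem_ker_of_mem_comap hf x (ker_le_comap π M hx)
  obtain ⟨φ, hφ⟩ := SuperHom.exists_subquotient_map (((ker ρ).lcs c).toQuotient.comp f)
    (subquotientIncl (ker ρ ⊓ (⊤ : GradedIdeal K F').lcs c) ((ker ρ).lcs c))
    (subquotientIncl_injective _ _) (ker π ⊓ (⊤ : GradedIdeal K F).lcs c) ((ker π).lcs c)
    (fun x hx => ⟨Submodule.Quotient.mk
      ⟨f x, hR x hx.1, map_lcs_mem f (J := ⊤) (fun _ _ => trivial) c x hx.2⟩, rfl⟩)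
    (fun x hx => toQuotient_eq_zero.2 (map_lcs_mem f hR c x hx))
  refine ⟨φ, fun f' hf' x => (hφ x).trans (toQuotient_eq.2 ?_)⟩
  -- Two lifts agree modulo S = ker ρ, hence on γ_{c+1}(F) modulo γ_{c+1}(S, F'), which is 0 in the
  -- target.
  refine sub_mem_lcs f f' (fun z => mem_ker.2 ?_) c x x.2.2
  rw [map_sub, hf, hf', sub_self]

variable {φ : SuperHom K (Multiplier π c) (Multiplier ρ c)} {f : SuperHom K F F'}
  {h : SuperHom K F' F}

/-- If f x lies in γ_{c+1}(S, F'), then h (f x) lies in γ_{c+1}(T, F), where T = π⁻¹(M); and h (f x)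
- x lies there too, since h ∘ f is the identity modulo T and x ∈ γ_{c+1}(F). Conversely f maps T
into S. -/
theorem map_mk_eq_zero_iff (hf : ∀ x, ρ (f x) = M.toQuotient (π x))
    (hh : ∀ y, M.toQuotient (π (h y)) = ρ y)
    (hφ : ∀ x : (ker π ⊓ (⊤ : GradedIdeal K F).lcs c).toSubmodule,
      subquotientIncl _ _ (φ (Submodule.Quotient.mk x)) = ((ker ρ).lcs c).toQuotient (f x))
    (x : (ker π ⊓ (⊤ : GradedIdeal K F).lcs c).toSubmodule) :
    φ (Submodule.Quotient.mk x) = 0 ↔ (x : F) ∈ ((comap π M).lcs c).toSubmodule := by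
  rw [← map_eq_zero_iff _ (subquotientIncl_injective _ _), hφ, toQuotient_eq_zero]
  constructor
  · intro hx
    have h1 := map_lcs_mem h (mem_comap_of_mem_ker hh) c _ hx
    have h2 := sub_mem_lcs (h.comp f) (SuperHom.id K F) (I := comap π M) (fun z => by
      refine (toQuotient_eq_zero (I := M) (x := π _)).1 ?_
      simp only [map_sub, SuperHom.comp_apply, SuperHom.id_apply]
      rw [hh, hf, sub_self]) c x x.2.2
    have := sub_mem h1 h2
    simpa using this
  · exact map_lcs_mem f (mem_ker_of_mem_comap hf) c _

/-- Common criterion for both sequences: it suffices that the image of α consists exactly of the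
classes of R ∩ γ_{c+1}(T, F), which is the kernel of φ. -/
theorem exact_map_of_image {A : Type w} [AddCommGroup A] [Module K A] [LieSuperalgebra K A]
    {α : SuperHom K A (Multiplier π c)} (hf : ∀ x, ρ (f x) = M.toQuotient (π x))
    (hh : ∀ y, M.toQuotient (π (h y)) = ρ y)
    (hφ : ∀ x : (ker π ⊓ (⊤ : GradedIdeal K F).lcs c).toSubmodule,
      subquotientIncl _ _ (φ (Submodule.Quotient.mk x)) = ((ker ρ).lcs c).toQuotient (f x))
    (hα : ∀ a, ∃ x ∈ ((comap π M).lcs c).toSubmodule,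
      subquotientIncl _ _ (α a) = ((ker π).lcs c).toQuotient x)
    (hα' : ∀ x ∈ ((comap π M).lcs c).toSubmodule, x ∈ (ker π).toSubmodule →
      ∃ a, subquotientIncl _ _ (α a) = ((ker π).lcs c).toQuotient x) :
    Function.Exact α φ := by
  intro z
  obtain ⟨x, rfl⟩ := Submodule.Quotient.mk_surjective _ z
  rw [map_mk_eq_zero_iff hf hh hφ]
  constructor
  · intro hx
    obtain ⟨a, ha⟩ := hα' x hx x.2.1
    exact ⟨a, subquotientIncl_injective _ _ ha⟩
  · rintro ⟨a, ha⟩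
    obtain ⟨x', hx', e⟩ := hα a
    rw [ha] at e
    -- Representatives differ by γ_{c+1}(R, F) ⊆ γ_{c+1}(T, F), so membership in the latter does not
    -- depend on the representative.
    have h1 : (x : F) - x' ∈ ((ker π).lcs c).toSubmodule := toQuotient_eq.1 e
    have := add_mem (lcs_mono (ker_le_comap π M) c h1) hx'
    rwa [sub_add_cancel] at this

variable {D : Type w} [AddCommGroup D] [Module K D] [SuperAlgebra K D]
variable {B : Type w} [AddCommGroup B] [Module K B] [SuperAlgebra K B]
variable {i : SuperHom K D B} {u : SuperHom K L B}

/-- The connecting map induced by all lifts `F' → L` of `ρ`. -/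
theorem exists_connecting (hi : Function.Injective i)
    (hu : ∀ z, u z = 0 ↔ z ∈ (M.lcs c).toSubmodule)
    (hD : ∀ z ∈ (M ⊓ (⊤ : GradedIdeal K L).lcs c).toSubmodule, ∃ d, i d = u z)
    {g : SuperHom K F' L} (hg : ∀ y, M.toQuotient (g y) = ρ y) :
    ∃ δ : SuperHom K (Multiplier ρ c) D,
      ∀ g : SuperHom K F' L, (∀ y, M.toQuotient (g y) = ρ y) →
        ∀ y : (ker ρ ⊓ (⊤ : GradedIdeal K F').lcs c).toSubmodule,
          i (δ (Submodule.Quotient.mk y)) = u (g y) := by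
  obtain ⟨δ, hδ⟩ := SuperHom.exists_subquotient_map (u.comp g) i hi
    (ker ρ ⊓ (⊤ : GradedIdeal K F').lcs c) ((ker ρ).lcs c)
    (fun y hy => hD _ ⟨mem_of_mem_ker hg y hy.1,
      map_lcs_mem g (J := ⊤) (fun _ _ => trivial) c y hy.2⟩)
    (fun y hy => (hu _).2 (map_lcs_mem g (mem_of_mem_ker hg) c y hy))
  refine ⟨δ, fun g' hg' y => (hδ y).trans ?_⟩
  rw [← sub_eq_zero, SuperHom.comp_apply, ← map_sub, hu]
  refine sub_mem_lcs g g' (fun z => toQuotient_eq_zero.1 ?_) c y y.2.2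
  rw [map_sub, hg, hg', sub_self]

/-- The pair (u, i) covers both connecting maps. For δ, u is the projection of L modulo γ_{c+1}(M,
L) and i the inclusion of the subquotient; for ε, where γ_{c+1}(M, L) = 0, u is the identity of L
and i the inclusion of M ∩ γ_{c+1}(L). The lift of ρ used here is π ∘ h. -/
theorem exact_connecting (hπ : Function.Surjective π)
    (hf : ∀ x, ρ (f x) = M.toQuotient (π x)) (hh : ∀ y, M.toQuotient (π (h y)) = ρ y)
    (hφ : ∀ x : (ker π ⊓ (⊤ : GradedIdeal K F).lcs c).toSubmodule,
      subquotientIncl _ _ (φ (Submodule.Quotient.mk x)) = ((ker ρ).lcs c).toQuotient (f x))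
    (hi : Function.Injective i) (hu : ∀ z, u z = 0 ↔ z ∈ (M.lcs c).toSubmodule)
    (hD : ∀ d, ∃ z ∈ (M ⊓ (⊤ : GradedIdeal K L).lcs c).toSubmodule, i d = u z)
    {δ : SuperHom K (Multiplier ρ c) D}
    (hδ : ∀ y : (ker ρ ⊓ (⊤ : GradedIdeal K F').lcs c).toSubmodule,
      i (δ (Submodule.Quotient.mk y)) = u (π (h y))) :
    Function.Exact φ δ ∧ Function.Surjective δ := by
  -- π ∘ h ∘ f and π agree modulo M, so on γ_{c+1}(F) they differ by elements of γ_{c+1}(M, L), the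
  -- kernel of u.
  have hcongr : ∀ x ∈ ((⊤ : GradedIdeal K F).lcs c).toSubmodule, u (π (h (f x))) = u (π x) := by
    intro x hx
    rw [← sub_eq_zero, ← map_sub, hu]
    refine sub_mem_lcs ((π.comp h).comp f) π (fun z => toQuotient_eq_zero.1 ?_) c x hx
    simp only [map_sub, SuperHom.comp_apply]
    rw [hh, hf, sub_self]
  have hTS := mem_ker_of_mem_comap hf
  constructor
  · intro z
    obtain ⟨y, rfl⟩ := Submodule.Quotient.mk_surjective _ z
    rw [← map_eq_zero_iff i.toLinearMap hi, hδ, hu]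
    constructor
    · intro hy
      -- Correct h y by an element t of γ_{c+1}(T, F) with the same image in L. Then h y - t
      -- represents a class in M^(c)(L), and its image under f is y modulo γ_{c+1}(S, F'), since f
      -- (h y) ≡ y and f t ∈ γ_{c+1}(S, F').
      obtain ⟨t, ht, e⟩ := exists_lcs_preimage π hπ (I := comap π M) (J := M) (fun m hm => by
        obtain ⟨t, rfl⟩ := hπ m
        exact ⟨t, hm, rfl⟩) c _ hy
      have hx : h y - t ∈ (ker π ⊓ (⊤ : GradedIdeal K F).lcs c).toSubmodule := by
        refine ⟨mem_ker.2 ?_, sub_mem ?_ (lcs_mono le_top c ht)⟩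
        · rw [map_sub, e, sub_self]
        · exact map_lcs_mem h (J := ⊤) (fun _ _ => trivial) c y y.2.2
      refine ⟨Submodule.Quotient.mk ⟨_, hx⟩, subquotientIncl_injective _ _ ?_⟩
      rw [hφ]
      refine (toQuotient_eq (x := f (h y - t)) (y := (y : F'))).2 ?_
      have h1 := sub_mem_lcs (f.comp h) (SuperHom.id K F') (I := ker ρ) (fun z => mem_ker.2 (by
        simp only [map_sub, SuperHom.comp_apply, SuperHom.id_apply]
        rw [hf, hh, sub_self])) c y y.2.2
      have h2 := sub_mem h1 (map_lcs_mem f hTS c t ht)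
      rw [map_sub]
      convert h2 using 1
      simp only [SuperHom.comp_apply, SuperHom.id_apply]
      abel
    · rintro ⟨z, hz⟩
      obtain ⟨x, rfl⟩ := Submodule.Quotient.mk_surjective _ z
      rw [← hu, ← hδ, ← hz]
      have hfx : f x ∈ (ker ρ ⊓ (⊤ : GradedIdeal K F').lcs c).toSubmodule :=
        ⟨hTS x (ker_le_comap π M x.2.1), map_lcs_mem f (J := ⊤) (fun _ _ => trivial) c x x.2.2⟩
      have e : φ (Submodule.Quotient.mk x) = Submodule.Quotient.mk ⟨f x, hfx⟩ :=
        subquotientIncl_injective _ _ (hφ x)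
      rw [e, hδ, hcongr x x.2.2, mem_ker.1 x.2.1, map_zero]
  · intro d
    obtain ⟨z, hz, e⟩ := hD d
    -- A preimage x of z in γ_{c+1}(F) has π x ∈ M, so f x lies in S ∩ γ_{c+1}(F') and its class
    -- maps to d.
    obtain ⟨x, hx, rfl⟩ := exists_lcs_preimage π hπ (I := ⊤) (J := ⊤) (fun m _ => by
        obtain ⟨t, rfl⟩ := hπ m
        exact ⟨t, trivial, rfl⟩) c z hz.2
    refine ⟨Submodule.Quotient.mk ⟨f x, hTS x hz.1,
      map_lcs_mem f (J := ⊤) (fun _ _ => trivial) c x hx⟩, hi ?_⟩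
    rw [hδ, e]
    exact hcongr x hx

/-! ### The homomorphisms from M ∧ᶜ L and M ∧ᶜ (L / γ_{n+1}(L)) to F / γ_{c+1}(R, F) -/

/-- The inverse of `F / R ≅ L`, restricted to `M`. -/
theorem exists_section (hπ : Function.Surjective π) (M : GradedIdeal K L) :
    ∃ Ψ : SuperHom K M.toSubmodule (F ⧸ (ker π).toSubmodule),
      ∀ m x, Ψ m = (ker π).toSubmodule.mkQ x ↔ (m : L) = π x := by
  obtain ⟨k, hk⟩ := π.exists_quotient_lift (ker π) fun x hx => hx
  have hinj : Function.Injective k := by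
    refine (injective_iff_map_eq_zero k.toLinearMap).2 fun x hx => ?_
    obtain ⟨x, rfl⟩ := Submodule.mkQ_surjective _ x
    rw [hk] at hx
    exact toQuotient_eq_zero.2 hx
  obtain ⟨Ψ, hΨ⟩ := M.incl.exists_factor_of_injective k hinj fun m => by
    obtain ⟨x, hx⟩ := hπ (m : L)
    exact ⟨(ker π).toSubmodule.mkQ x, (hk x).trans hx⟩
  refine ⟨Ψ, fun m x => ?_⟩
  rw [← hinj.eq_iff, hΨ, hk]
  rfl

/-- The induction starts from M ≅ T / R. Compatibility records what the first sequence needs: the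
image is γ_{c+1}(T, F) / γ_{c+1}(R, F), and composing with the map to L gives θ_c. -/
theorem exists_crossed_hom (hπ : Function.Surjective π) (M : GradedIdeal K L) (c : ℕ) :
    ∃ Ψ : SuperHom K (M.ExtPower c) (F ⧸ ((ker π).lcs c).toSubmodule),
      (M.crossed.extPow c).IsCompatible π ((comap π M).lcs c) ((ker π).lcs c) Ψ ∧
      ∀ (x : F) (hx : π x ∈ M.toSubmodule) (y : Fin c → F),
        Ψ (M.crossed.iterWedge ⟨π x, hx⟩ c (fun i => π (y i))) =
          ((ker π).lcs c).toQuotient (iterBr K x c y) := by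
  obtain ⟨Ψ, hΨ⟩ := exists_section hπ M
  have hC : M.crossed.IsCompatible π (comap π M) (ker π) Ψ := by
    constructor
    · intro m
      obtain ⟨x, hx⟩ := hπ (M.toSubmodule.subtype m)
      exact ⟨x, show π x ∈ M.toSubmodule from hx ▸ Subtype.property (p := (· ∈ M.toSubmodule)) m, (hΨ m x).2 hx.symm⟩
    · intro x hx
      exact ⟨⟨π x, hx⟩, (hΨ _ _).2 rfl⟩
    · intro y m x hx
      refine (hΨ _ _).2 ?_
      rw [π.map_br, ← (hΨ m x).1 hx]
      rfl
    · intro m x hx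
      exact (hΨ m x).1 hx
  obtain ⟨Ψ', h, hw⟩ := hC.exists_extPow_hom hπ (ker_le_comap π M) (fun _ hx => hx)
    (fun j x hx y hy => by
      -- Here ker q is R itself, and [γ_{j+1}(T, F), R] ⊆ [γ_{j+1}(F), R] ⊆ γ_{j+2}(R, F).
      have := br_mem_comm (br_lcs_lcs_mem (ker π) j 0) y hy x (lcs_mono le_top j hx)
      rwa [Nat.zero_add] at this) c
  exact ⟨Ψ', h, fun x hx y => hw _ x y ((hΨ _ _).2 rfl)⟩

/-- π maps γ_{k+1}(T, F) into γ_{k+1}(M, L), which vanishes. It is used with k = n to define the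
pairings and with k = c to place the image in the multiplier. -/
theorem comap_lcs_le_ker {n : ℕ} (hn : M.IsCentral n) (π : SuperHom K F L) {k : ℕ} (hk : n ≤ k) :
    ((comap π M).lcs k).toSubmodule ≤ (ker π).toSubmodule :=
  fun x hx => mem_ker.2 (hn.lcs_eq_zero hk _ (map_lcs_mem π (fun _ h => h) k x hx))

/-- The same induction as for M ∧ᶜ L, now along q : F → L / γ_{n+1}(L). The kernel of q is R +
γ_{n+1}(F), and centrality of M is what makes brackets with the second summand harmless. -/
theorem exists_crossedQuot_hom (hπ : Function.Surjective π) {n : ℕ} (hn : M.IsCentral n) (c : ℕ) :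
    ∃ Ψ : SuperHom K (M.ExtPowerQuot hn c) (F ⧸ ((ker π).lcs c).toSubmodule),
      (∀ t, ∃ x ∈ ((comap π M).lcs c).toSubmodule, Ψ t = ((ker π).lcs c).toQuotient x) ∧
      (∀ x ∈ ((comap π M).lcs c).toSubmodule, ∃ t, Ψ t = ((ker π).lcs c).toQuotient x) ∧
      ∀ (x : F) (hx : π x ∈ M.toSubmodule) (y : Fin c → F),
        Ψ ((M.crossedQuot _ hn.br_lcs_eq_zero).iterWedge ⟨π x, hx⟩ c
          (fun i => toQuotient _ (π (y i)))) = ((ker π).lcs c).toQuotient (iterBr K x c y) := by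
  obtain ⟨Ψ, hΨ⟩ := exists_section hπ M
  set q := (toQuotient ((⊤ : GradedIdeal K L).lcs n)).comp π with hqdef
  have hq : Function.Surjective q := fun p => by
    obtain ⟨l, rfl⟩ := Submodule.mkQ_surjective _ p
    obtain ⟨x, rfl⟩ := hπ l
    exact ⟨x, rfl⟩
  have hC : (M.crossedQuot _ hn.br_lcs_eq_zero).IsCompatible q (comap π M) (ker π) Ψ := by
    constructor
    · intro m
      obtain ⟨x, hx⟩ := hπ (M.toSubmodule.subtype m)
      exact ⟨x, show π x ∈ M.toSubmodule from hx ▸ Subtype.property (p := (· ∈ M.toSubmodule)) m, (hΨ m x).2 hx.symm⟩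
    · intro x hx
      exact ⟨(⟨π x, hx⟩ : M.toSubmodule), (hΨ _ _).2 rfl⟩
    · intro y m x hx
      refine (hΨ _ _).2 ?_
      rw [π.map_br, ← (hΨ m x).1 hx]
      rfl
    · intro m x hx
      exact congrArg (toQuotient ((⊤ : GradedIdeal K L).lcs n)) ((hΨ m x).1 hx)
  obtain ⟨Ψ', h, hw⟩ := hC.exists_extPow_hom hq (ker_le_comap π M)
    (fun x hx => by rw [hqdef, SuperHom.comp_apply, mem_ker.1 hx, map_zero])
    (fun j x hx y hy => by
      have hy' : π y ∈ ((⊤ : GradedIdeal K L).lcs n).toSubmodule := toQuotient_eq_zero.1 hy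
      -- Split y into y - y' ∈ R and y' ∈ γ_{n+1}(F).
      obtain ⟨y', hy', e⟩ := exists_lcs_preimage π hπ (I := ⊤) (J := ⊤) (fun m _ => by
        obtain ⟨t, rfl⟩ := hπ m
        exact ⟨t, trivial, rfl⟩) n _ hy'
      have hr : y - y' ∈ (ker π).toSubmodule := mem_ker.2 (by rw [map_sub, e, sub_self])
      have h1 := br_mem_comm (br_lcs_lcs_mem (ker π) j 0) _ hr x (lcs_mono le_top j hx)
      rw [Nat.zero_add] at h1
      have h2 := br_lcs_lcs_mem (comap π M) n j x hx y' hy'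
      -- [x, y'] lies in γ_{j+n+2}(T, F), which is γ_{j+2} of the ideal γ_{n+1}(T, F); as that ideal
      -- is contained in R, the bracket lies in γ_{j+2}(R, F).
      rw [show j + n + 1 = n + (j + 1) by ring, lcs_add] at h2
      have := add_mem h1 (lcs_mono (comap_lcs_le_ker hn π le_rfl) (j + 1) h2)
      rwa [← map_add, sub_add_cancel] at this) c
  exact ⟨Ψ', h.exists_mem, h.surj, fun x hx y => hw _ x y ((hΨ _ _).2 rfl)⟩

end Multiplier

end

/-! ### The two exact sequences -/

open GradedIdeal

theorem propositionp11 {K : Type u} {L : Type v} [CommRing K] [AddCommGroup L] [Module K L]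
    [LieSuperalgebra K L] (M : GradedIdeal K L) (c : ℕ) (hc : 1 ≤ c)
    -- free presentations `F(X) → L` and `F(Y) → L / M`
    {X : Type w₁} (dX : X → ZMod 2) (π : SuperHom K (FreeLieSuper K dX) L)
    (hπ : Function.Surjective π)
    {Y : Type w₂} (dY : Y → ZMod 2) (ρ : SuperHom K (FreeLieSuper K dY) (L ⧸ M.toSubmodule))
    (hρ : Function.Surjective ρ) :
    -- `φ : M^(c)(L) → M^(c)(L / M)` is the map induced by `L → L / M`
    ∃ φ : SuperHom K (Multiplier π c) (Multiplier ρ c),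
      (∀ f : SuperHom K (FreeLieSuper K dX) (FreeLieSuper K dY),
        (∀ x, ρ (f x) = M.toQuotient (π x)) →
        ∀ x : (GradedIdeal.ker π ⊓ (⊤ : GradedIdeal K (FreeLieSuper K dX)).lcs c).toSubmodule,
          GradedIdeal.subquotientIncl _ _ (φ (Submodule.Quotient.mk x)) =
            ((GradedIdeal.ker ρ).lcs c).toQuotient (f x)) ∧
      -- the first sequence
      (∃ (α : SuperHom K (GradedIdeal.ker (M.theta c)).toSubmodule (Multiplier π c))
        (δ : SuperHom K (Multiplier ρ c)
          (GradedIdeal.Subquotient (M ⊓ (⊤ : GradedIdeal K L).lcs c) (M.lcs c))),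
        -- `α` is the restriction of `m ∧ l₁ ∧ ⋯ ∧ l_c ↦ [⋯[x, y₁], ⋯, y_c]`
        (∃ Ψ : SuperHom K (M.ExtPower c)
            (FreeLieSuper K dX ⧸ ((GradedIdeal.ker π).lcs c).toSubmodule),
          (∀ (x : FreeLieSuper K dX) (hx : π x ∈ M.toSubmodule) (y : Fin c → FreeLieSuper K dX),
            Ψ (M.crossed.iterWedge ⟨π x, hx⟩ c (fun i => π (y i))) =
              ((GradedIdeal.ker π).lcs c).toQuotient (iterBr K x c y)) ∧
          ∀ k : (GradedIdeal.ker (M.theta c)).toSubmodule,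
            GradedIdeal.subquotientIncl _ _ (α k) = Ψ k) ∧
        -- `δ` is induced by any lift `F(Y) → L` of `ρ`
        (∀ g : SuperHom K (FreeLieSuper K dY) L, (∀ y, M.toQuotient (g y) = ρ y) →
          ∀ y : (GradedIdeal.ker ρ ⊓ (⊤ : GradedIdeal K (FreeLieSuper K dY)).lcs c).toSubmodule,
            GradedIdeal.subquotientIncl _ _ (δ (Submodule.Quotient.mk y)) =
              (M.lcs c).toQuotient (g y)) ∧
        Function.Exact α φ ∧ Function.Exact φ δ ∧ Function.Surjective δ) ∧
      -- the second sequence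
      (∀ (n : ℕ) (hn : M.IsCentral n), n ≤ c →
        ∃ (β : SuperHom K (M.ExtPowerQuot hn c) (Multiplier π c))
          (ε : SuperHom K (Multiplier ρ c) (M ⊓ (⊤ : GradedIdeal K L).lcs c).toSubmodule),
        (∀ (x : FreeLieSuper K dX) (hx : π x ∈ M.toSubmodule) (y : Fin c → FreeLieSuper K dX),
          GradedIdeal.subquotientIncl _ _ (β ((M.crossedQuot _ hn.br_lcs_eq_zero).iterWedge
              ⟨π x, hx⟩ c (fun i => GradedIdeal.toQuotient _ (π (y i))))) =
            ((GradedIdeal.ker π).lcs c).toQuotient (iterBr K x c y)) ∧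
        (∀ g : SuperHom K (FreeLieSuper K dY) L, (∀ y, M.toQuotient (g y) = ρ y) →
          ∀ y : (GradedIdeal.ker ρ ⊓ (⊤ : GradedIdeal K (FreeLieSuper K dY)).lcs c).toSubmodule,
            (ε (Submodule.Quotient.mk y) : L) = g y) ∧
        Function.Exact β φ ∧ Function.Exact φ ε ∧ Function.Surjective ε) := by
  obtain ⟨f, hf⟩ := FreeLieSuper.exists_lift dX ρ hρ (M.toQuotient.comp π)
  have hMπ : Function.Surjective (M.toQuotient.comp π) := fun p => by
    obtain ⟨l, rfl⟩ := Submodule.mkQ_surjective _ p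
    obtain ⟨x, rfl⟩ := hπ l
    exact ⟨x, rfl⟩
  -- Lifting ρ all the way to F gives a map back to F and, as π ∘ h, also a lift F' → L of ρ.
  obtain ⟨h, hh⟩ := FreeLieSuper.exists_lift dY (M.toQuotient.comp π) hMπ ρ
  obtain ⟨φ, hφ⟩ := Multiplier.exists_map (c := c) hf
  refine ⟨φ, hφ, ?_, fun n hn hnc => ?_⟩
  · obtain ⟨Ψ, hΨ, hw⟩ := Multiplier.exists_crossed_hom hπ M c
    -- On ker θ_c a representative x ∈ γ_{c+1}(T, F) of Ψ k satisfies π x = θ_c(k) = 0, so Ψ takes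
    -- values in the multiplier there.
    obtain ⟨α, hα⟩ := (Ψ.comp (ker (M.theta c)).incl).exists_factor_of_injective
      (subquotientIncl (ker π ⊓ (⊤ : GradedIdeal K (FreeLieSuper K dX)).lcs c) ((ker π).lcs c))
      (subquotientIncl_injective _ _) (fun k => by
        obtain ⟨x, hx, e⟩ := hΨ.exists_mem (k : M.ExtPower c)
        refine ⟨Submodule.Quotient.mk ⟨x, ?_, lcs_mono le_top c hx⟩, e.symm⟩
        exact mem_ker.2 ((hΨ.bd _ x e).symm.trans (mem_ker.1 k.2)))
    have hu : ∀ z, (M.lcs c).toQuotient z = 0 ↔ z ∈ (M.lcs c).toSubmodule :=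
      fun z => toQuotient_eq_zero
    obtain ⟨δ, hδ⟩ := Multiplier.exists_connecting (g := π.comp h)
      (subquotientIncl_injective (M ⊓ (⊤ : GradedIdeal K L).lcs c) (M.lcs c)) hu
      (fun z hz => ⟨Submodule.Quotient.mk ⟨z, hz⟩, rfl⟩) hh
    refine ⟨α, δ, ⟨Ψ, hw, hα⟩, hδ, ?_, ?_⟩
    · refine Multiplier.exact_map_of_image hf hh (hφ f hf) (fun k => ?_) (fun x hx hx' => ?_)
      · obtain ⟨x, hx, e⟩ := hΨ.exists_mem (k : M.ExtPower c)
        exact ⟨x, hx, (hα k).trans e⟩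
      · obtain ⟨k, hk⟩ := hΨ.surj x hx
        -- A preimage k under Ψ of the class of x ∈ R lies in ker θ_c automatically, because θ_c(k)
        -- = π x = 0.
        exact ⟨⟨k, mem_ker.2 ((hΨ.bd k x hk).trans hx')⟩, (hα _).trans hk⟩
    · refine Multiplier.exact_connecting hπ hf hh (hφ f hf) (subquotientIncl_injective _ _) hu
        (fun d => ?_) (hδ (π.comp h) hh)
      obtain ⟨z, rfl⟩ := Submodule.Quotient.mk_surjective _ d
      exact ⟨z, z.2, rfl⟩
  · obtain ⟨Ψ, hΨ, hΨ', hw⟩ := Multiplier.exists_crossedQuot_hom hπ hn c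
    have hle := Multiplier.comap_lcs_le_ker hn π hnc
    obtain ⟨β, hβ⟩ := Ψ.exists_factor_of_injective
      (subquotientIncl (ker π ⊓ (⊤ : GradedIdeal K (FreeLieSuper K dX)).lcs c) ((ker π).lcs c))
      (subquotientIncl_injective _ _) (fun t => by
        obtain ⟨x, hx, e⟩ := hΨ t
        exact ⟨Submodule.Quotient.mk ⟨x, hle hx, lcs_mono le_top c hx⟩, e.symm⟩)
    -- Since n ≤ c, γ_{c+1}(M, L) = 0, so the identity of L plays the role of the projection modulo
    -- γ_{c+1}(M, L).
    have hu : ∀ z, SuperHom.id K L z = 0 ↔ z ∈ (M.lcs c).toSubmodule := fun z => by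
      refine ⟨fun hz => ?_, hn.lcs_eq_zero hnc z⟩
      rw [show z = 0 from hz]
      exact Submodule.zero_mem _
    have hinj : Function.Injective (M ⊓ (⊤ : GradedIdeal K L).lcs c).incl :=
      Subtype.val_injective
    obtain ⟨ε, hε⟩ := Multiplier.exists_connecting (g := π.comp h) hinj hu
      (fun z hz => ⟨⟨z, hz⟩, rfl⟩) hh
    refine ⟨β, ε, fun x hx y => (hβ _).trans (hw x hx y), hε, ?_, ?_⟩
    · refine Multiplier.exact_map_of_image hf hh (hφ f hf) (fun t => ?_) (fun x hx _ => ?_)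
      · obtain ⟨x, hx, e⟩ := hΨ t
        exact ⟨x, hx, (hβ t).trans e⟩
      · obtain ⟨t, ht⟩ := hΨ' x hx
        exact ⟨t, (hβ t).trans ht⟩
    · exact Multiplier.exact_connecting hπ hf hh (hφ f hf) hinj hu
        (fun d => ⟨d, d.2, rfl⟩) (hε (π.comp h) hh)
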